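/- **Conventions.** A uniform commutative monoid is a commutative monoid with a uniformity for which addition is uniformly continuous. Let $X,Z$ be uniform commutative monoids, $Z$ Hausdorff, and let $S$ be a set. A subset of $Z$ is *relatively complete* if its closure is complete. $Z^X$ is the set of all maps $X\to Z$ with the topology of pointwise convergence; for $x\in X$, $y\in Z^X$ write $x.y:=y(x)$. A *disjoint* family or sequence is a pairwise disjoint one. Let $\mathcal K,\mathcal G$ be families of subsets of $S$. For $f:S\to X$ and $\alpha\subseteq S$, write $f\prec\alpha$ ($f$ is *supported by* $\alpha$) if there is $\kappa\in\mathcal K$ with $\kappa\subseteq\alpha$ and $f=0$ on $S\setminus\kappa$; $f$ *equals $x$ over* $\alpha$ if there is $\gamma\in\mathcal G$ with $\alpha\subseteq\gamma$ and $f=x$ on $\gamma$. For a family $\mathcal B$ of subsets of $X$ put $\mathcal B\text{-}\mathrm{hull}(x)=\bigcap\{B\in\mathcal B: x\in B\}$. For a family $\mathcal F$ of functions $S\to X$ put $\mathcal F_B=\{f\in\mathcal F: f(S)\subseteq B\}$. **Riesz system.** $(S,(\mathcal K,\mathcal G),(X,\mathcal B),(\mathcal F,\mathcal T))$, where $\mathcal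 F$ is a family of functions $S\to X$ and $\mathcal T$ a uniformity on $\mathcal F$, is a *Riesz system* if: 1. $\emptyset\in\mathcal K$ and $\mathcal K$ is closed under unions of two members; 2. $\emptyset\in\mathcal G$, $\bigcup\mathcal G\in\mathcal G$, and $\mathcal G$ is closed under unions and intersections of two members; 3. $\kappa\setminus\gamma\in\mathcal K$ and $\gamma\setminus\kappa\in\mathcal G$ for all $\kappa\in\mathcal K$, $\gamma\in\mathcal G$; 4. if $\kappa\in\mathcal K$, $\gamma\in\mathcal G$, $\kappa\subseteq\gamma$, there are $\gamma'\in\mathcal G$, $\kappa'\in\mathcal K$ with $\kappa\subseteq\gamma'\subseteq\kappa'\subseteq\gamma$; 5. $\mathcal B$ is closed under arbitrary non-empty intersections, and $0\in B$ for all $B\in\mathcal B$; 6. for all $B,B'\in\mathcal B$ there is $C\in\mathcal B$ with $B+B'\subseteq C$; 7. every $x\in X$ lies in some $B\in\mathcal B$; 8. $\mathcal F$ contains $0$, is closed under pointwise addition, and is a uniform commutative monoid under $\mathcal T$; 9. every $f\in\mathcal F$ has range in some $B\in\mathcal B$; 10. for every $f\in\mathcal F$ and every entourage $W$ of $X$ there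 is a finite $G\subseteq\mathcal G$ with $S=\bigcup G$ and $(f(s),f(t))\in W$ whenever $s,t\in\gamma\in G$; 11. for all $\kappa\in\mathcal K$, $\gamma\in\mathcal G$ with $\kappa\subseteq\gamma$ and all $x\in X$ there is $f\in\mathcal F$ with range in $\mathcal B\text{-}\mathrm{hull}(x)$, $f\prec\gamma$, and $f$ equal to $x$ over $\kappa$; 12. for all $B\in\mathcal B$ and $T\in\mathcal T$ there is an entourage $U$ of $X$ such that, whenever $\kappa\in\mathcal K$, $\gamma,\omega\in\mathcal G$, $\kappa\subseteq\omega\subseteq\gamma$, $f,g\in\mathcal F_B$, $f\prec\gamma$, $g\prec\gamma$ and $(f(s),g(s))\in U$ for all $s\in\omega$, there are $p,q\in\mathcal F_B$ with $p\prec\gamma\setminus\kappa$, $q\prec\gamma\setminus\kappa$ and $(f+p,g+q)\in T$; 13. for all $B\in\mathcal B$, finite $G\subseteq\mathcal G$, $\kappa\in\mathcal K$ with $\kappa\subseteq\bigcup G$, and $f\in\mathcal F_B$ there are $g_\gamma\in\mathcal F_B$ $(\gamma\in G)$ with $g_\gamma\prec\gamma$, $\sum_{\gamma\in J}g_\gamma\in\mathcal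 F_B$ for all $J\subseteq G$, and $f=\sum_{\gamma\in G}g_\gamma$ on $\kappa$. **Riesz integral.** Let $\mathcal E$ be the smallest field of subsets of $S$ containing $\mathcal K\cup\mathcal G$. A map $\ell:\mathcal F\to Z$ with $\ell(0)=0$ is a *$Z$-valued Riesz integral* over the Riesz system if - $\ell(f+g)=\ell(f)+\ell(g)$ whenever $f,g\in\mathcal F$ and there are disjoint $E,E'\in\mathcal E$ with $f\prec E$, $g\prec E'$; - for all $B\in\mathcal B$, entourages $W$ of $Z$ and disjoint sequences $(G_n)_{n\in\mathbb N}$ in $\mathcal G$ there is $m$ with $(\ell(f),\ell(f+g))\in W$ for all $n>m$ and $f,g\in\mathcal F_B$ with $g\prec G_n$; - for each $B\in\mathcal B$, $\ell$ is uniformly continuous on $\mathcal F_B$ and $\ell(\mathcal F_B)$ is relatively complete. **The set function $\nu_\ell$.** For $\kappa\in\mathcal K$ and $x\in X$, $\tau_\ell(\kappa)(x)\in Z$ is the limit of the filter base of all sets $$\{\ell(f): f\in\mathcal F_B,\ f\text{ equals }x\text{ over }\kappa,\ f\prec\beta\},\qquad \beta\in\mathcal G,\ \beta\supseteq\kappa,$$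 where $B=\mathcal B\text{-}\mathrm{hull}(x)$. For $\gamma\in\mathcal G$ and $\alpha\subseteq S$ put, with limits in $Z^X$, $$\xi_\ell(\gamma)=\lim_{\kappa\in\mathcal K,\ \kappa\subseteq\gamma}\tau_\ell(\kappa),\qquad \nu_\ell(\alpha)=\lim_{\gamma\in\mathcal G,\ \gamma\supseteq\alpha}\xi_\ell(\gamma),$$ where $\kappa$ increases and $\gamma$ decreases. **Riesz measure.** Let $h$ be a $Z^X$-valued function on all subsets of $S$. For $B\in\mathcal B$ and an entourage $W$ of $Z$, a set $\alpha\subseteq S$ is *$W$-small* with respect to $(h,B)$ if there is $\gamma\in\mathcal G$ with $\alpha\subseteq\gamma$ such that $\big(\sum_{\kappa\in K}x_\kappa.h(\kappa),\ \sum_{\kappa\in K}(x_\kappa+y_\kappa).h(\kappa)\big)\in W$ for all finite disjoint $K\subseteq\mathcal K$ with $\bigcup K\subseteq\gamma$ and all $x,y:K\to B$. Let $\mathcal R_h$ be the family of all $\alpha\subseteq S$ such that for all $B\in\mathcal B$ and all entourages $V$ of $Z$ there are $\kappa\in\mathcal K$, $\gamma\in\mathcal G$ with $\kappa\subseteq\alpha\subseteq\gamma$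 and $\gamma\setminus\kappa$ $V$-small with respect to $(h,B)$. Then $h$ is a *Riesz measure* over $(\mathcal K,\mathcal G,\mathcal B)$ if 1. $\mathcal G\subseteq\mathcal R_h$; 2. $\mathcal R_h$ is a field, $h(\emptyset)=0$, and $h(\alpha\cup\beta)+h(\alpha\cap\beta)=h(\alpha)+h(\beta)$ for all $\alpha,\beta\in\mathcal R_h$; 3. $h(\gamma)=\lim_{\kappa\in\mathcal K,\,\kappa\subseteq\gamma}h(\kappa)$ for all $\gamma\in\mathcal G$ and $h(\alpha)=\lim_{\gamma\in\mathcal G,\,\gamma\supseteq\alpha}h(\gamma)$ for all $\alpha\subseteq S$; 4. for every entourage $W$ of $Z$ and $B\in\mathcal B$ there is an entourage $U$ of $X$ such that $\big(\sum_{\rho\in R}x_\rho.h(\rho),\sum_{\rho\in R}y_\rho.h(\rho)\big)\in W$ for all finite disjoint $R\subseteq\mathcal R_h$ and $x,y:R\to B$ with $(x_\rho,y_\rho)\in U$ for all $\rho\in R$; 5. for every $B\in\mathcal B$, disjoint sequence $(\alpha_n)$ in $\mathcal R_h$ and entourage $V$ of $Z$ there is $m$ such that $\alpha_n$ is $V$-small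 with respect to $(h,B)$ for all $n>m$; 6. for every $B\in\mathcal B$, the set of all sums $\sum_{\rho\in R}x_\rho.h(\rho)$ with $R\subseteq\mathcal R_h$ finite disjoint and $x:R\to B$ is relatively complete. **Theorem.** Let $\ell$ be a $Z$-valued Riesz integral over a Riesz system $(S,(\mathcal K,\mathcal G),(X,\mathcal B),(\mathcal F,\mathcal T))$. Then all limits defining $\tau_\ell$ on $\mathcal K$, $\xi_\ell$ on $\mathcal G$ and $\nu_\ell$ on all subsets of $S$ exist (for $\tau_\ell(\kappa)(x)$, the sets above form a base of a proper filter converging to $\tau_\ell(\kappa)(x)$ for every $B\in\mathcal B$ with $x\in B$), and $\nu_\ell$ is a Riesz measure over $(\mathcal K,\mathcal G,\mathcal B)$. -/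

import Mathlib

open Set Filter Topology Uniformity

/-- A commutative monoid with a uniformity is a uniform commutative monoid if its addition is
uniformly continuous. -/
class IsUniformAddMonoid (M : Type*) [AddCommMonoid M] [UniformSpace M] : Prop where
  uniformContinuous_add : UniformContinuous fun p : M × M => p.1 + p.2

/-!
Every uniform commutative monoid has a base of entourages that are closed, symmetric and
translation invariant. All conditions below that quantify over entourages are monotone in the
entourage, so that it is the same to quantify over this base or over all entourages.
-/

namespace Riesz

variable {S X Z : Type*}

/-- `f ≺ α`: the function `f` vanishes outside some member of `K` contained in `α`. -/
def SupportedBy [Zero X] (K : Set (Set S)) (f : S → X) (α : Set S) : Prop :=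
  ∃ κ ∈ K, κ ⊆ α ∧ ∀ s, s ∉ κ → f s = 0

/-- `f` equals `x` over `α`: it is constantly `x` on some member of `G` containing `α`. -/
def EqualsOver (G : Set (Set S)) (f : S → X) (x : X) (α : Set S) : Prop :=
  ∃ γ ∈ G, α ⊆ γ ∧ ∀ s ∈ γ, f s = x

/-- The `B`-hull of a point: the intersection of all members of `B` containing it. -/
def hull (B : Set (Set X)) (x : X) : Set X := ⋂₀ {A ∈ B | x ∈ A}

/-- A subset of a uniform space is relatively complete if its closure is complete. -/
def IsRelativelyComplete [UniformSpace Z] (A : Set Z) : Prop := IsComplete (closure A)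

end Riesz

open Riesz

/-- A Riesz system `(S, (K, G), (X, B), (F, T))`. The uniformity `T` on `F` is a datum; it need not
be induced by the uniformity of `X`. -/
structure RieszSystem (S X : Type*) [AddCommMonoid X] [UniformSpace X] where
  /-- "closed" sets -/
  K : Set (Set S)
  /-- "open" sets -/
  G : Set (Set S)
  /-- "bounded" sets -/
  B : Set (Set X)
  /-- the functions; they contain `0` and are closed under pointwise addition -/
  F : AddSubmonoid (S → X)
  /-- the uniformity on the functions -/
  T : UniformSpace F
  -- `K` is closed under finite unions, the empty one included
  K_empty : ∅ ∈ K
  K_union : ∀ κ₁ ∈ K, ∀ κ₂ ∈ K, κ₁ ∪ κ₂ ∈ K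
  -- `G` is closed under finite unions and under finite intersections; the empty union is `∅`, the
  -- empty intersection is by convention the union of all members of `G`
  G_empty : ∅ ∈ G
  G_union : ∀ γ₁ ∈ G, ∀ γ₂ ∈ G, γ₁ ∪ γ₂ ∈ G
  G_sUnion : ⋃₀ G ∈ G
  G_inter : ∀ γ₁ ∈ G, ∀ γ₂ ∈ G, γ₁ ∩ γ₂ ∈ G
  K_diff : ∀ κ ∈ K, ∀ γ ∈ G, κ \ γ ∈ K
  G_diff : ∀ κ ∈ K, ∀ γ ∈ G, γ \ κ ∈ G
  interpolate : ∀ κ ∈ K, ∀ γ ∈ G, κ ⊆ γ →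
    ∃ γ' ∈ G, ∃ κ' ∈ K, κ ⊆ γ' ∧ γ' ⊆ κ' ∧ κ' ⊆ γ
  B_sInter : ∀ H : Set (Set X), H ⊆ B → H.Nonempty → ⋂₀ H ∈ B
  B_zero : ∀ A ∈ B, (0 : X) ∈ A
  B_add : ∀ A₁ ∈ B, ∀ A₂ ∈ B, ∃ C ∈ B, ∀ x ∈ A₁, ∀ y ∈ A₂, x + y ∈ C
  B_cover : ∀ x : X, ∃ A ∈ B, x ∈ A
  F_uniform : @IsUniformAddMonoid F _ T
  F_bounded : ∀ f : F, ∃ A ∈ B, range (f : S → X) ⊆ A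
  /-- every function is finitely `G`-partitionable -/
  F_partitionable : ∀ f : F, ∀ W ∈ 𝓤 X, ∃ H : Finset (Set S), (H : Set (Set S)) ⊆ G ∧
    ⋃₀ (H : Set (Set S)) = univ ∧
    ∀ γ ∈ H, ∀ s ∈ γ, ∀ t ∈ γ, ((f : S → X) s, (f : S → X) t) ∈ W
  F_bump : ∀ κ ∈ K, ∀ γ ∈ G, κ ⊆ γ → ∀ x : X, ∃ f : F,
    range (f : S → X) ⊆ hull B x ∧ SupportedBy K (f : S → X) γ ∧ EqualsOver G (f : S → X) x κ
  /-- functions that are close near `κ` have extensions that are close everywhere -/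
  F_extend : ∀ A ∈ B, ∀ D ∈ @uniformity F T, ∃ U ∈ 𝓤 X, ∀ κ ∈ K, ∀ γ ∈ G, κ ⊆ γ →
    ∀ f g : F, range (f : S → X) ⊆ A → range (g : S → X) ⊆ A →
      SupportedBy K (f : S → X) γ → SupportedBy K (g : S → X) γ →
      (∃ ω ∈ G, κ ⊆ ω ∧ ω ⊆ γ ∧ ∀ s ∈ ω, ((f : S → X) s, (g : S → X) s) ∈ U) →
      ∃ p q : F, range (p : S → X) ⊆ A ∧ range (q : S → X) ⊆ A ∧
        SupportedBy K (p : S → X) (γ \ κ) ∧ SupportedBy K (q : S → X) (γ \ κ) ∧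
        (f + p, g + q) ∈ D
  /-- "partitions of unity" -/
  F_decompose : ∀ A ∈ B, ∀ H : Finset (Set S), (H : Set (Set S)) ⊆ G →
    ∀ κ ∈ K, κ ⊆ ⋃₀ (H : Set (Set S)) → ∀ f : F, range (f : S → X) ⊆ A →
      ∃ g : Set S → F,
        (∀ γ ∈ H, range (g γ : S → X) ⊆ A ∧ SupportedBy K (g γ : S → X) γ) ∧
        (∀ J : Finset (Set S), J ⊆ H → range ((∑ γ ∈ J, g γ : F) : S → X) ⊆ A) ∧
        ∀ s ∈ κ, (f : S → X) s = ((∑ γ ∈ H, g γ : F) : S → X) s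

namespace RieszSystem

variable {S X Z : Type*} [AddCommMonoid X] [UniformSpace X] (R : RieszSystem S X)

/-- `F_A`: the functions in `F` with range in `A`. -/
def FB (A : Set X) : Set R.F := {f | range (f : S → X) ⊆ A}

/-- The smallest field of subsets of `S` containing `K ∪ G`. -/
def E : Set (Set S) := MeasureTheory.generateSetAlgebra (R.K ∪ R.G)

/-- `E`-separated functions: they are supported by disjoint members of `E`. -/
def Separated (f g : R.F) : Prop :=
  ∃ E₁ ∈ R.E, ∃ E₂ ∈ R.E, Disjoint E₁ E₂ ∧
    SupportedBy R.K (f : S → X) E₁ ∧ SupportedBy R.K (g : S → X) E₂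

/-- `ℓ` is a `Z`-valued Riesz integral over the Riesz system `R`. -/
structure IsRieszIntegral [AddCommMonoid Z] [UniformSpace Z] (ℓ : R.F → Z) : Prop where
  map_zero : ℓ 0 = 0
  /-- `E`-additivity -/
  map_add : ∀ f g : R.F, R.Separated f g → ℓ (f + g) = ℓ f + ℓ g
  /-- `s`-boundedness over `B` -/
  sBounded : ∀ A ∈ R.B, ∀ W ∈ 𝓤 Z, ∀ G : ℕ → Set S, (∀ n, G n ∈ R.G) →
    Pairwise (fun i j => Disjoint (G i) (G j)) →
    ∃ m : ℕ, ∀ n > m, ∀ f ∈ R.FB A, ∀ g ∈ R.FB A, SupportedBy R.K (g : S → X) (G n) →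
      (ℓ f, ℓ (f + g)) ∈ W
  uniformContinuousOn : ∀ A ∈ R.B, @UniformContinuousOn R.F Z R.T _ ℓ (R.FB A)
  relativelyComplete : ∀ A ∈ R.B, IsRelativelyComplete (ℓ '' R.FB A)

/-- The functions in `F` with range in `A` that equal `x` over `κ` and are supported by `γ`. -/
def bumps (x : X) (κ γ : Set S) (A : Set X) : Set R.F :=
  {f | f ∈ R.FB A ∧ EqualsOver R.G (f : S → X) x κ ∧ SupportedBy R.K (f : S → X) γ}

/-- The filter on `Z` generated by the images under `ℓ` of the sets `R.bumps x κ β A`, where `β`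
runs through the members of `G` containing `κ` (these images decrease with `β`). -/
def tauFilter (ℓ : R.F → Z) (κ : Set S) (x : X) (A : Set X) : Filter Z :=
  ⨅ β ∈ {β | β ∈ R.G ∧ κ ⊆ β}, 𝓟 (ℓ '' R.bumps x κ β A)

/-- The members of `K` contained in `γ`; `atTop` is the direction of increasing sets. -/
abbrev KBelow (K : Set (Set S)) (γ : Set S) : Type _ := {κ : Set S // κ ∈ K ∧ κ ⊆ γ}

/-- The members of `G` containing `α`; `atBot` is the direction of decreasing sets. -/
abbrev GAbove (G : Set (Set S)) (α : Set S) : Type _ := {γ : Set S // γ ∈ G ∧ α ⊆ γ}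

section
variable [AddCommMonoid Z] [UniformSpace Z]

/-- `τ_ℓ`, of interest on `K`. -/
noncomputable def tau (ℓ : R.F → Z) (κ : Set S) : X → Z :=
  fun x => lim (R.tauFilter ℓ κ x (hull R.B x))

/-- `ξ_ℓ`, of interest on `G`: the inner limit of `τ_ℓ` over `K`. Limits in `X → Z` are
pointwise. -/
noncomputable def xi (ℓ : R.F → Z) (γ : Set S) : X → Z :=
  limUnder atTop fun κ : KBelow R.K γ => R.tau ℓ κ.1

/-- `ν_ℓ`, on all subsets of `S`: the outer limit of `ξ_ℓ` over `G`. -/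
noncomputable def nu (ℓ : R.F → Z) (α : Set S) : X → Z :=
  limUnder atBot fun γ : GAbove R.G α => R.xi ℓ γ.1

end

end RieszSystem

namespace Riesz

variable {S X Z : Type*} [AddCommMonoid X] [UniformSpace X] [AddCommMonoid Z] [UniformSpace Z]

/-- `α` is `W`-small with respect to `(h, A)`; only the values of `h` on `K` matter. -/
def IsSmall (K G : Set (Set S)) (h : Set S → X → Z) (A : Set X) (W : Set (Z × Z))
    (α : Set S) : Prop :=
  ∃ γ ∈ G, α ⊆ γ ∧ ∀ P : Finset (Set S), (P : Set (Set S)) ⊆ K →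
    (P : Set (Set S)).PairwiseDisjoint id → ⋃₀ (P : Set (Set S)) ⊆ γ →
    ∀ x y : Set S → X, (∀ κ ∈ P, x κ ∈ A) → (∀ κ ∈ P, y κ ∈ A) →
      (∑ κ ∈ P, h κ (x κ), ∑ κ ∈ P, h κ (x κ + y κ)) ∈ W

/-- `R_h`: the sets that are regular with respect to `(h, K, G, B)`. -/
def regularSets (K G : Set (Set S)) (B : Set (Set X)) (h : Set S → X → Z) : Set (Set S) :=
  {α | ∀ A ∈ B, ∀ V ∈ 𝓤 Z, ∃ κ ∈ K, ∃ γ ∈ G, κ ⊆ α ∧ α ⊆ γ ∧ IsSmall K G h A V (γ \ κ)}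

/-- The finite sums `∑ x_ρ . h(ρ)` over finite disjoint families of regular sets `ρ`, with all
`x_ρ` in `A`. -/
def partialSums (K G : Set (Set S)) (B : Set (Set X)) (h : Set S → X → Z) (A : Set X) : Set Z :=
  {z | ∃ P : Finset (Set S), (P : Set (Set S)) ⊆ regularSets K G B h ∧
    (P : Set (Set S)).PairwiseDisjoint id ∧
    ∃ x : Set S → X, (∀ ρ ∈ P, x ρ ∈ A) ∧ z = ∑ ρ ∈ P, h ρ (x ρ)}

def UniformlyPartitionContinuous (K G : Set (Set S)) (B : Set (Set X))
    (h : Set S → X → Z) : Prop :=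
  ∀ W ∈ 𝓤 Z, ∀ A ∈ B, ∃ U ∈ 𝓤 X, ∀ P : Finset (Set S),
    (P : Set (Set S)) ⊆ regularSets K G B h → (P : Set (Set S)).PairwiseDisjoint id →
    ∀ x y : Set S → X, (∀ ρ ∈ P, x ρ ∈ A) → (∀ ρ ∈ P, y ρ ∈ A) →
      (∀ ρ ∈ P, (x ρ, y ρ) ∈ U) →
      (∑ ρ ∈ P, h ρ (x ρ), ∑ ρ ∈ P, h ρ (y ρ)) ∈ W

def SBounded (K G : Set (Set S)) (B : Set (Set X)) (h : Set S → X → Z) : Prop :=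
  ∀ A ∈ B, ∀ α : ℕ → Set S, (∀ n, α n ∈ regularSets K G B h) →
    Pairwise (fun i j => Disjoint (α i) (α j)) →
    ∀ V ∈ 𝓤 Z, ∃ m : ℕ, ∀ n > m, IsSmall K G h A V (α n)

/-- `h`, defined on all subsets of `S` with values in `X → Z`, is a Riesz measure over
`(K, G, B)`. -/
structure IsRieszMeasure (K G : Set (Set S)) (B : Set (Set X)) (h : Set S → X → Z) : Prop where
  G_subset : G ⊆ regularSets K G B h
  isField : MeasureTheory.IsSetAlgebra (regularSets K G B h)
  -- `h` is additive on the field of regular sets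
  empty : h ∅ = 0
  additive : ∀ α ∈ regularSets K G B h, ∀ β ∈ regularSets K G B h,
    h (α ∪ β) + h (α ∩ β) = h α + h β
  inner_limit : ∀ γ ∈ G,
    Tendsto (fun κ : RieszSystem.KBelow K γ => h κ.1) atTop (𝓝 (h γ))
  outer_limit : ∀ α : Set S,
    Tendsto (fun γ : RieszSystem.GAbove G α => h γ.1) atBot (𝓝 (h α))
  uniformlyPartitionContinuous : UniformlyPartitionContinuous K G B h
  sBounded : SBounded K G B h
  relativelyComplete : ∀ A ∈ B, IsRelativelyComplete (partialSums K G B h A)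

end Riesz

/-!
The theorem constructs a measure from an integral `ℓ` that is additive only on functions with
disjoint supports, on values in a commutative monoid in which nothing can be subtracted.

The uniformity of `Z` is generated by pseudometrics `d` that all translations contract
(`exists_isContractivePseudometric`), so that closeness in `Z` can be estimated numerically. The
quantity behind all estimates is the variation of `ℓ` over a set `γ`: the supremum of the distances
between `ℓ f` and `ℓ (f + g)` for `f`, `g` with values in a fixed bounded set and `g` supported by
`γ` (`VariationLE`). Both functions have to vanish outside some member of `K`: `F` may contain other
functions, on which the values of `ℓ` are unrelated to `ν`.

* `s`-boundedness makes the variation regular: `γ \ κ` has small variation for suitable `κ ⊆ γ`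
  when `γ ∈ G` is given, and for suitable `γ ⊇ κ` when `κ ∈ K` is given
  (`exists_variationLE_of_exhaustion`).
* Functions supported by `γ` that are close near `κ` have close integrals up to the variation over
  `γ \ κ`, because the Riesz system extends them to functions that are close everywhere
  (`exists_comparison`). Together with partitions of unity this makes the variation finitely
  subadditive (`variationLE_biUnion`), and hence small along sequences that are disjoint up to sets
  of small variation (`exists_variationLE_of_almost_disjoint`).

By regularity and comparison, the nets that define `τ` and `ξ` are Cauchy in the closure of the
integrals of functions with values in a bounded set, which is complete. For `ν` the decreasing net
of neighbourhoods of an arbitrary set is Cauchy since a decreasing sequence in `G` with large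
consecutive differences would give an almost disjoint sequence of large variation
(`exists_G_forall_variationLE`). If `κ ⊆ α ⊆ γ` and `γ \ κ` has small variation, then `ν α x` is
close to `τ κ x` (`dist_tau_nu_le`).

Smallness with respect to `ν` is the same as small variation of `ℓ`: in one direction sums
`∑ τ (κ i) (x i)` are limits of integrals; in the other direction, the integral of any
function that vanishes outside some member of `K` is approximated by such sums, over disjoint
members of `K` that nearly exhaust `S` and on which the function is nearly constant
(`variationLE_of_dist_sum_tau_le`). Hence the regular sets are those that can be approximated up to
small variation (`mem_regularSets_nu_iff`), and the properties of a Riesz measure follow from those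
of `τ` on `K`, where sums over disjoint sets are limits of integrals of functions with disjoint
supports.
-/

/-! ### Translation-contractive pseudometrics -/

/-- A uniformly continuous pseudometric on a uniform commutative monoid for which all translations
are contractions. The uniformity of the monoid is generated by these pseudometrics, see
`exists_isContractivePseudometric`. -/
structure IsContractivePseudometric {M : Type*} [AddCommMonoid M] [UniformSpace M]
    (d : M → M → ℝ) : Prop where
  self : ∀ a, d a a = 0
  symm : ∀ a b, d a b = d b a
  triangle : ∀ a b c, d a c ≤ d a b + d b c
  add_right : ∀ a b c, d (a + c) (b + c) ≤ d a b
  mem_uniformity : ∀ ε > 0, {p : M × M | d p.1 p.2 < ε} ∈ 𝓤 M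

section Pseudometric

variable {M : Type*} [AddCommMonoid M] [UniformSpace M]

theorem exists_entourage_add_mem [IsUniformAddMonoid M] {W : Set (M × M)} (hW : W ∈ 𝓤 M) :
    ∃ V ∈ 𝓤 M, V ⊆ W ∧ ∀ a b c d : M, (a, b) ∈ V → (c, d) ∈ V → (a + c, b + d) ∈ W := by
  have h := (IsUniformAddMonoid.uniformContinuous_add (M := M)) hW
  rw [uniformity_prod_eq_comap_prod, mem_map, mem_comap] at h
  obtain ⟨Y, hY, hYW⟩ := h
  obtain ⟨V, hV, hVY⟩ := mem_prod_same_iff.1 hY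
  refine ⟨V ∩ W, inter_mem hV hW, inter_subset_right, fun a b c d hab hcd => ?_⟩
  exact @hYW ((a, c), (b, d)) (hVY ⟨hab.1, hcd.1⟩)

theorem exists_invariant_entourage [IsUniformAddMonoid M] {W : Set (M × M)} (hW : W ∈ 𝓤 M) :
    ∃ V ∈ 𝓤 M, V ⊆ W ∧ (∀ a b, (a, b) ∈ V → (b, a) ∈ V) ∧
      ∀ a b c, (a, b) ∈ V → (a + c, b + c) ∈ V := by
  obtain ⟨W', hW', hs, hsub⟩ := symm_of_uniformity hW
  obtain ⟨V, hV, -, hVW⟩ := exists_entourage_add_mem hW'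
  refine ⟨{p | ∀ c, (p.1 + c, p.2 + c) ∈ W'}, mem_of_superset hV fun p hp c =>
    hVW _ _ _ _ hp (refl_mem_uniformity hV), ?_, fun a b h c => hs.symm _ _ (h c), ?_⟩
  · rintro ⟨a, b⟩ h
    exact hsub (by simpa using h 0)
  · intro a b c h e
    simpa [add_assoc] using h (c + e)

/-- The contractive pseudometrics generate the uniformity. The construction is that of a pseudometric
from a sequence of entourages, here translation invariant ones, followed by a supremum over all
translates. -/
theorem exists_isContractivePseudometric [IsUniformAddMonoid M] {W : Set (M × M)}
    (hW : W ∈ 𝓤 M) :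
    ∃ d : M → M → ℝ, IsContractivePseudometric d ∧ ∀ a b, d a b < 1 → (a, b) ∈ W := by
  classical
  let T := {V : Set (M × M) // V ∈ 𝓤 M ∧ (∀ a b, (a, b) ∈ V → (b, a) ∈ V) ∧
      ∀ a b c, (a, b) ∈ V → (a + c, b + c) ∈ V}
  have step : ∀ V : T, ∃ V' : T, ∀ a b c e, (a, b) ∈ V'.1 → (b, c) ∈ V'.1 → (c, e) ∈ V'.1 →
      (a, e) ∈ V.1 := by
    intro V
    obtain ⟨Y, hY, hYV⟩ := comp_mem_uniformity_sets V.2.1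
    obtain ⟨Y', hY', hYV'⟩ := comp_mem_uniformity_sets hY
    obtain ⟨V', h1, h2, h3⟩ := exists_invariant_entourage (inter_mem hY' hY)
    refine ⟨⟨V', h1, h3⟩, fun a b c e hab hbc hce => hYV ⟨c, hYV' ⟨b, ?_, ?_⟩, ?_⟩⟩
    exacts [(h2 hab).1, (h2 hbc).1, (h2 hce).2]
  choose next hnext using step
  obtain ⟨V₀, hV₀, hV₀W, hV₀'⟩ := exists_invariant_entourage hW
  let U : ℕ → T := fun n => Nat.rec ⟨V₀, hV₀, hV₀'⟩ (fun _ V => next V) n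
  have hU3 : ∀ n a b c e, (a, b) ∈ (U (n + 1)).1 → (b, c) ∈ (U (n + 1)).1 →
      (c, e) ∈ (U (n + 1)).1 → (a, e) ∈ (U n).1 := fun n => hnext (U n)
  have hrefl : ∀ n a, (a, a) ∈ (U n).1 := fun n a => refl_mem_uniformity (U n).2.1
  have hanti : Antitone fun n => (U n).1 := antitone_nat_of_succ_le fun n p hp =>
    hU3 n p.1 p.1 p.1 p.2 (hrefl (n + 1) p.1) (hrefl (n + 1) p.1) hp
  let d : M → M → NNReal := fun x y =>
    if h : ∃ n, (x, y) ∉ (U n).1 then (1 / 2) ^ Nat.find h else 0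
  have hr : (1 / 2 : NNReal) ∈ Ioo (0 : NNReal) 1 :=
    ⟨half_pos one_pos, NNReal.half_lt_self one_ne_zero⟩
  have hle_d : ∀ {x y : M} {n : ℕ}, (1 / 2) ^ n ≤ d x y ↔ (x, y) ∉ (U n).1 := by
    intro x y n
    dsimp only [d]
    split_ifs with h
    · rw [(pow_right_strictAnti₀ hr.1 hr.2).le_iff_ge, Nat.find_le_iff]
      exact ⟨fun ⟨m, hmn, hm⟩ hn => hm (hanti hmn hn), fun h => ⟨n, le_rfl, h⟩⟩
    · push Not at h
      simp only [h, not_true, (pow_pos hr.1 _).not_ge]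
  have hmono : ∀ x y x' y', (∀ n, (x, y) ∈ (U n).1 → (x', y') ∈ (U n).1) → d x' y' ≤ d x y := by
    intro x y x' y' h
    by_cases H : ∃ n, (x', y') ∉ (U n).1
    · have : d x' y' = (1 / 2) ^ Nat.find H := dif_pos H
      rw [this, hle_d]
      exact fun hn => Nat.find_spec H (h _ hn)
    · exact (dif_neg H).trans_le zero_le
  have hself : ∀ x, d x x = 0 := fun x => dif_neg (by simp [hrefl])
  have hsymm : ∀ x y, d x y = d y x := fun x y =>
    le_antisymm (hmono _ _ _ _ fun n => (U n).2.2.1 _ _) (hmono _ _ _ _ fun n => (U n).2.2.1 _ _)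
  have hd1 : ∀ x y, d x y ≤ 1 := by
    intro x y
    dsimp only [d]
    split_ifs
    exacts [pow_le_one₀ hr.1.le hr.2.le, zero_le_one]
  let I := PseudoMetricSpace.ofPreNNDist d hself hsymm
  let ρ : M → M → ℝ := I.dist
  have hρd : ∀ x y, ρ x y ≤ d x y := PseudoMetricSpace.dist_ofPreNNDist_le _ _ _
  have hdρ : ∀ x y, ↑(d x y) ≤ 2 * ρ x y := by
    refine PseudoMetricSpace.le_two_mul_dist_ofPreNNDist _ _ _ fun x₁ x₂ x₃ x₄ => ?_
    by_cases H : ∃ n, (x₁, x₄) ∉ (U n).1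
    · refine (dif_pos H).trans_le ?_
      rw [← div_le_iff₀' zero_lt_two, ← mul_one_div (_ ^ _), ← pow_succ]
      simp only [le_max_iff, hle_d, ← not_and_or]
      rintro ⟨h₁₂, h₂₃, h₃₄⟩
      exact Nat.find_spec H (hU3 _ _ _ _ _ h₁₂ h₂₃ h₃₄)
    · exact (dif_neg H).trans_le zero_le
  have htrans : ∀ x y c, d (x + c) (y + c) ≤ d x y := fun x y c =>
    hmono _ _ _ _ fun n => (U n).2.2.2 _ _ _
  -- The largest pseudometric below `d` need not contract translations; its supremum over all
  -- translates does, and it is still squeezed between `d / 2` and `d`.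
  let σ : M → M → ℝ := fun x y => 4 * ⨆ c, ρ (x + c) (y + c)
  have hσd' : ∀ x y c, ρ (x + c) (y + c) ≤ d x y := fun x y c =>
    (hρd _ _).trans (NNReal.coe_le_coe.2 (htrans _ _ _))
  have hbdd : ∀ x y, BddAbove (range fun c => ρ (x + c) (y + c)) := fun x y =>
    ⟨d x y, by rintro _ ⟨c, rfl⟩; exact hσd' x y c⟩
  have hσd : ∀ x y, σ x y ≤ 4 * d x y := fun x y =>
    mul_le_mul_of_nonneg_left (ciSup_le (hσd' x y)) (by norm_num)
  have hdσ : ∀ x y, 2 * (d x y : ℝ) ≤ σ x y := by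
    intro x y
    have h1 := le_ciSup (hbdd x y) 0
    have h2 := hdρ x y
    simp only [add_zero] at h1
    simp only [σ]
    linarith
  refine ⟨σ, ⟨?_, ?_, ?_, ?_, ?_⟩, ?_⟩
  · intro a
    have h1 := hσd a a
    have h2 := hdσ a a
    simp only [hself, NNReal.coe_zero, mul_zero] at h1 h2
    exact le_antisymm h1 h2
  · intro a b
    simp only [σ]
    congr 2
    ext c
    exact I.dist_comm _ _
  · intro a b c
    simp only [σ, ← mul_add]
    refine mul_le_mul_of_nonneg_left (ciSup_le fun e => ?_) (by norm_num)
    exact (I.dist_triangle _ (b + e) _).trans (add_le_add (le_ciSup (hbdd a b) e)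
      (le_ciSup (hbdd b c) e))
  · intro a b c
    simp only [σ]
    refine mul_le_mul_of_nonneg_left (ciSup_le fun e => ?_) (by norm_num)
    have := le_ciSup (hbdd a b) (c + e)
    simpa only [add_assoc] using this
  · intro ε hε
    obtain ⟨n, hn⟩ := exists_pow_lt_of_lt_one (show 0 < ε / 4 by linarith)
      (show (1 / 2 : ℝ) < 1 by norm_num)
    refine mem_of_superset (U n).2.1 fun p hp => ?_
    have h1 : d p.1 p.2 < (1 / 2) ^ n := not_le.1 fun h => hle_d.1 h hp
    have h2 : (d p.1 p.2 : ℝ) < (1 / 2) ^ n := by exact_mod_cast NNReal.coe_lt_coe.2 h1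
    have := hσd p.1 p.2
    simp only [mem_ofPred_eq]
    linarith
  · intro a b h
    refine hV₀W (by_contra fun h0 => ?_)
    have h1 : (1 / 2) ^ 0 ≤ d a b := hle_d.2 h0
    have h2 : (1 : ℝ) ≤ d a b := by exact_mod_cast h1
    have := hdσ a b
    linarith

namespace IsContractivePseudometric

variable {d : M → M → ℝ} (hd : IsContractivePseudometric d)
include hd

theorem add_left (a b c : M) : d (c + a) (c + b) ≤ d a b := by
  rw [add_comm c a, add_comm c b]
  exact hd.add_right a b c

theorem add_add (a b c e : M) : d (a + c) (b + e) ≤ d a b + d c e :=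
  (hd.triangle _ (b + c) _).trans (add_le_add (hd.add_right _ _ _) (hd.add_left _ _ _))

theorem sum_sum {ι : Type*} (s : Finset ι) (a b : ι → M) :
    d (∑ i ∈ s, a i) (∑ i ∈ s, b i) ≤ ∑ i ∈ s, d (a i) (b i) := by
  classical
  induction s using Finset.induction_on with
  | empty => simp [hd.self]
  | insert i s hi ih =>
    rw [Finset.sum_insert hi, Finset.sum_insert hi, Finset.sum_insert hi]
    exact (hd.add_add _ _ _ _).trans (add_le_add le_rfl ih)

theorem eventually_nhds (z : M) {ε : ℝ} (hε : 0 < ε) : ∀ᶠ w in 𝓝 z, d w z < ε := by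
  filter_upwards [UniformSpace.ball_mem_nhds z (hd.mem_uniformity ε hε)] with w hw
  rw [hd.symm]
  exact hw

/-- Closed `d`-balls are closed. -/
theorem le_of_tendsto {ι : Type*} {l : Filter ι} [l.NeBot] {u : ι → M} {z a : M} {c : ℝ}
    (hu : Tendsto u l (𝓝 z)) (h : ∀ᶠ i in l, d a (u i) ≤ c) : d a z ≤ c := by
  refine le_of_forall_pos_le_add fun ε hε => ?_
  obtain ⟨i, h1, h2⟩ := (h.and (hu.eventually (hd.eventually_nhds z hε))).exists
  have := hd.triangle a (u i) z
  linarith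

end IsContractivePseudometric

theorem eq_of_forall_pseudometric [IsUniformAddMonoid M] [T2Space M] {a b : M}
    (h : ∀ d : M → M → ℝ, IsContractivePseudometric d → ∀ ε > 0, d a b ≤ ε) : a = b := by
  refine eq_of_uniformity fun {W} hW => ?_
  obtain ⟨d, hd, hdW⟩ := exists_isContractivePseudometric hW
  exact hdW _ _ ((h d hd (1 / 2) (by norm_num)).trans_lt (by norm_num))

theorem mem_closure_of_forall_pseudometric [IsUniformAddMonoid M] {a : M} {A : Set M}
    (h : ∀ d : M → M → ℝ, IsContractivePseudometric d → ∀ ε > 0, ∃ b ∈ A, d a b ≤ ε) :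
    a ∈ closure A := by
  rw [UniformSpace.mem_closure_iff_ball]
  intro W hW
  obtain ⟨d, hd, hdW⟩ := exists_isContractivePseudometric hW
  obtain ⟨b, hb, hab⟩ := h d hd (1 / 2) (by norm_num)
  exact ⟨b, hdW _ _ (hab.trans_lt (by norm_num)), hb⟩

/-- A filter on a complete set that is Cauchy for every contractive pseudometric converges. -/
theorem exists_le_nhds_of_isComplete [IsUniformAddMonoid M] {l : Filter M} [l.NeBot] {A : Set M}
    (hA : IsComplete A) (hl : A ∈ l)
    (h : ∀ d : M → M → ℝ, IsContractivePseudometric d → ∀ ε > 0, ∃ z, ∀ᶠ w in l, d z w ≤ ε) :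
    ∃ z, l ≤ 𝓝 z := by
  have hc : Cauchy l := by
    refine cauchy_iff.2 ⟨inferInstance, fun W hW => ?_⟩
    obtain ⟨d, hd, hdW⟩ := exists_isContractivePseudometric hW
    obtain ⟨z, hz⟩ := h d hd (1 / 3) (by norm_num)
    refine ⟨_, hz, ?_⟩
    rintro ⟨a, b⟩ ⟨ha, hb⟩
    refine hdW _ _ ?_
    have h1 := hd.triangle a z b
    have h2 := hd.symm a z
    simp only [mem_ofPred_eq] at ha hb
    linarith
  obtain ⟨z, -, hz⟩ := hA l hc (le_principal_iff.2 hl)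
  exact ⟨z, hz⟩

end Pseudometric

/-! ### Supports and separation in a Riesz system -/

namespace Riesz

variable {S X : Type*} [Zero X]

theorem SupportedBy.mono {K : Set (Set S)} {f : S → X} {α β : Set S}
    (h : SupportedBy K f α) (hαβ : α ⊆ β) : SupportedBy K f β := by
  obtain ⟨κ, hκ, h1, h2⟩ := h
  exact ⟨κ, hκ, h1.trans hαβ, h2⟩

theorem SupportedBy.eq_zero {K : Set (Set S)} {f : S → X} {α : Set S}
    (h : SupportedBy K f α) {t : S} (ht : t ∉ α) : f t = 0 := by
  obtain ⟨κ, hκ, h1, h2⟩ := h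
  exact h2 t fun h => ht (h1 h)

end Riesz

namespace RieszSystem

variable {S X Z : Type*} [AddCommMonoid X] [UniformSpace X] (R : RieszSystem S X)

theorem univ_mem_G : univ ∈ R.G := by
  obtain ⟨H, hH, hU, -⟩ := R.F_partitionable 0 univ univ_mem
  have : ⋃₀ R.G = univ := univ_subset_iff.1 (hU ▸ sUnion_subset_sUnion hH)
  exact this ▸ R.G_sUnion

theorem biUnion_mem_G {ι : Type*} (s : Finset ι) {γ : ι → Set S} (h : ∀ i ∈ s, γ i ∈ R.G) :
    ⋃ i ∈ s, γ i ∈ R.G := by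
  classical
  induction s using Finset.induction_on with
  | empty => simpa using R.G_empty
  | insert i s hi ih =>
    rw [Finset.set_biUnion_insert]
    exact R.G_union _ (h i (Finset.mem_insert_self i s)) _
      (ih fun j hj => h j (Finset.mem_insert_of_mem hj))

theorem biUnion_mem_K {ι : Type*} (s : Finset ι) {κ : ι → Set S} (h : ∀ i ∈ s, κ i ∈ R.K) :
    ⋃ i ∈ s, κ i ∈ R.K := by
  classical
  induction s using Finset.induction_on with
  | empty => simpa using R.K_empty
  | insert i s hi ih =>
    rw [Finset.set_biUnion_insert]
    exact R.K_union _ (h i (Finset.mem_insert_self i s)) _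
      (ih fun j hj => h j (Finset.mem_insert_of_mem hj))

/-- Finitely many disjoint members of `K` have disjoint neighbourhoods in `G`. -/
theorem exists_disjoint_nhds {ι : Type*} (s : Finset ι) {κ γ : ι → Set S}
    (hκ : ∀ i ∈ s, κ i ∈ R.K) (hγ : ∀ i ∈ s, γ i ∈ R.G) (hκγ : ∀ i ∈ s, κ i ⊆ γ i)
    (hd : ∀ i ∈ s, ∀ j ∈ s, i ≠ j → Disjoint (κ i) (κ j)) :
    ∃ β : ι → Set S, (∀ i ∈ s, β i ∈ R.G) ∧ (∀ i ∈ s, κ i ⊆ β i) ∧ (∀ i ∈ s, β i ⊆ γ i) ∧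
      ∀ i ∈ s, ∀ j ∈ s, i ≠ j → Disjoint (β i) (β j) := by
  classical
  have key : ∀ i, ∃ β κ', i ∈ s → β ∈ R.G ∧ κ' ∈ R.K ∧ κ i ⊆ β ∧ β ⊆ κ' ∧
      κ' ⊆ γ i \ ⋃ j ∈ s.erase i, κ j := by
    intro i
    by_cases hi : i ∈ s
    · obtain ⟨β, hβ, κ', hκ', h1, h2, h3⟩ := R.interpolate (κ i) (hκ i hi)
        (γ i \ ⋃ j ∈ s.erase i, κ j)
        (R.G_diff _ (R.biUnion_mem_K _ fun j hj => hκ j (Finset.mem_of_mem_erase hj)) _ (hγ i hi))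
        (subset_sdiff.2 ⟨hκγ i hi, disjoint_iUnion₂_right.2 fun j hj =>
          hd i hi j (Finset.mem_of_mem_erase hj) (Finset.ne_of_mem_erase hj).symm⟩)
      exact ⟨β, κ', fun _ => ⟨hβ, hκ', h1, h2, h3⟩⟩
    · exact ⟨∅, ∅, fun h => absurd h hi⟩
  choose β κ' h using key
  refine ⟨fun i => β i \ ⋃ j ∈ s.erase i, κ' j, fun i hi => ?_, fun i hi => ?_, fun i hi => ?_,
    fun i hi j hj hij => ?_⟩
  · exact R.G_diff _ (R.biUnion_mem_K _ fun j hj => (h j (Finset.mem_of_mem_erase hj)).2.1) _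
      (h i hi).1
  · refine subset_sdiff.2 ⟨(h i hi).2.2.1, disjoint_iUnion₂_right.2 fun j hj => ?_⟩
    have h1 := (subset_sdiff.1 (h j (Finset.mem_of_mem_erase hj)).2.2.2.2).2
    refine (disjoint_iUnion₂_right.1 h1 i ?_).symm
    exact Finset.mem_erase.2 ⟨(Finset.ne_of_mem_erase hj).symm, hi⟩
  · exact sdiff_subset.trans ((h i hi).2.2.2.1.trans ((h i hi).2.2.2.2.trans sdiff_subset))
  · refine disjoint_left.2 fun t ht ht' => ht.2 ?_
    exact mem_biUnion (Finset.mem_erase.2 ⟨hij.symm, hj⟩) ((h j hj).2.2.2.1 ht'.1)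

section Hull

theorem hull_mem (x : X) : hull R.B x ∈ R.B := by
  obtain ⟨A, hA, hx⟩ := R.B_cover x
  exact R.B_sInter _ (fun _ h => h.1) ⟨A, hA, hx⟩

theorem mem_hull (x : X) : x ∈ hull R.B x := fun _ h => h.2

theorem hull_subset {A : Set X} (hA : A ∈ R.B) {x : X} (hx : x ∈ A) : hull R.B x ⊆ A :=
  sInter_subset_of_mem ⟨hA, hx⟩

/-- The bounded set `C` contains `A`, `A + A` and `A + A + A`. -/
structure Dominates (A C : Set X) : Prop where
  mem : C ∈ R.B
  subset : A ⊆ C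
  add : ∀ x ∈ A, ∀ y ∈ A, x + y ∈ C
  add_add : ∀ x ∈ A, ∀ y ∈ A, ∀ z ∈ A, x + y + z ∈ C

theorem exists_dominates {A : Set X} (hA : A ∈ R.B) : ∃ C, R.Dominates A C := by
  obtain ⟨A', hA', h⟩ := R.B_add A hA A hA
  obtain ⟨C, hC, h'⟩ := R.B_add A' hA' A hA
  have h0 := R.B_zero A hA
  refine ⟨C, hC, fun x hx => ?_, fun x hx y hy => ?_, fun x hx y hy z hz => h' _ (h x hx y hy) z hz⟩
  · simpa using h' _ (h x hx 0 h0) 0 h0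
  · simpa using h' _ (h x hx y hy) 0 h0

end Hull

section Functions

variable {R}

theorem supportedBy_zero (α : Set S) : SupportedBy R.K ((0 : R.F) : S → X) α :=
  ⟨∅, R.K_empty, empty_subset _, fun _ _ => rfl⟩

theorem supportedBy_add {f g : R.F} {α : Set S} (hf : SupportedBy R.K (f : S → X) α)
    (hg : SupportedBy R.K (g : S → X) α) : SupportedBy R.K ((f + g : R.F) : S → X) α := by
  obtain ⟨κ, hκ, h1, h2⟩ := hf
  obtain ⟨κ', hκ', h1', h2'⟩ := hg
  refine ⟨κ ∪ κ', R.K_union _ hκ _ hκ', union_subset h1 h1', fun t ht => ?_⟩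
  rw [mem_union, not_or] at ht
  simp [h2 t ht.1, h2' t ht.2]

theorem supportedBy_sum {ι : Type*} (s : Finset ι) {f : ι → R.F} {α : Set S}
    (h : ∀ i ∈ s, SupportedBy R.K (f i : S → X) α) :
    SupportedBy R.K ((∑ i ∈ s, f i : R.F) : S → X) α := by
  classical
  induction s using Finset.induction_on with
  | empty => simpa using supportedBy_zero α
  | insert i s hi ih =>
    rw [Finset.sum_insert hi]
    exact supportedBy_add (h i (Finset.mem_insert_self i s))
      (ih fun j hj => h j (Finset.mem_insert_of_mem hj))

theorem mem_FB {A : Set X} {f : R.F} : f ∈ R.FB A ↔ ∀ t, (f : S → X) t ∈ A := range_subset_iff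

variable (R) in
/-- The functions in `F` with range in `A` that vanish outside some member of `K`. A Riesz integral
is controlled by its values near members of `K` on such functions only. -/
def FS (A : Set X) : Set R.F := {f | f ∈ R.FB A ∧ SupportedBy R.K (f : S → X) univ}

theorem FS_mono {A A' : Set X} (h : A ⊆ A') : R.FS A ⊆ R.FS A' :=
  fun _ hf => ⟨hf.1.trans h, hf.2⟩

theorem zero_mem_FS {A : Set X} (hA : A ∈ R.B) : (0 : R.F) ∈ R.FS A :=
  ⟨mem_FB.2 fun _ => R.B_zero A hA, supportedBy_zero _⟩

theorem add_mem_FS {A A' C : Set X} (h : ∀ x ∈ A, ∀ y ∈ A', x + y ∈ C) {f g : R.F}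
    (hf : f ∈ R.FS A) (hg : g ∈ R.FS A') : f + g ∈ R.FS C :=
  ⟨mem_FB.2 fun t => h _ (mem_FB.1 hf.1 t) _ (mem_FB.1 hg.1 t), supportedBy_add hf.2 hg.2⟩

theorem mem_FS {A : Set X} {f : R.F} (hf : range (f : S → X) ⊆ A) {α : Set S}
    (h : SupportedBy R.K (f : S → X) α) : f ∈ R.FS A := ⟨hf, h.mono (subset_univ _)⟩

theorem bumps_subset_FS {x : X} {κ γ : Set S} {A : Set X} : R.bumps x κ γ A ⊆ R.FS A :=
  fun _ hf => mem_FS hf.1 hf.2.2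

theorem bumps_mono {x : X} {κ κ' γ γ' : Set S} {A : Set X} (hκ : κ ⊆ κ') (hγ : γ' ⊆ γ) :
    R.bumps x κ' γ' A ⊆ R.bumps x κ γ A := by
  rintro f ⟨h1, ⟨ω, hω, h2, h3⟩, h4⟩
  exact ⟨h1, ⟨ω, hω, hκ.trans h2, h3⟩, h4.mono hγ⟩

theorem bumps_nonempty {κ γ : Set S} (hκ : κ ∈ R.K) (hγ : γ ∈ R.G) (h : κ ⊆ γ) {A : Set X}
    (hA : A ∈ R.B) {x : X} (hx : x ∈ A) : (R.bumps x κ γ A).Nonempty := by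
  obtain ⟨f, h1, h2, h3⟩ := R.F_bump κ hκ γ hγ h x
  exact ⟨f, h1.trans (R.hull_subset hA hx), h3, h2⟩

theorem add_mem_bumps {x y : X} {κ γ : Set S} {A C : Set X} (h : ∀ x ∈ A, ∀ y ∈ A, x + y ∈ C)
    {f g : R.F} (hf : f ∈ R.bumps x κ γ A) (hg : g ∈ R.bumps y κ γ A) :
    f + g ∈ R.bumps (x + y) κ γ C := by
  obtain ⟨h1, ⟨ω, hω, h2, h3⟩, h4⟩ := hf
  obtain ⟨h1', ⟨ω', hω', h2', h3'⟩, h4'⟩ := hg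
  refine ⟨mem_FB.2 fun t => h _ (mem_FB.1 h1 t) _ (mem_FB.1 h1' t), ⟨ω ∩ ω', R.G_inter _ hω _ hω',
    subset_inter h2 h2', fun t ht => ?_⟩, supportedBy_add h4 h4'⟩
  simp [h3 t ht.1, h3' t ht.2]

section DisjointSums

variable {ι : Type*} {s : Finset ι} {β : ι → Set S} {f : ι → R.F}
  (hβ : ∀ i ∈ s, ∀ j ∈ s, i ≠ j → Disjoint (β i) (β j))
  (hf : ∀ i ∈ s, SupportedBy R.K (f i : S → X) (β i))
include hβ hf

theorem sum_apply_of_mem {i : ι} (hi : i ∈ s) {t : S} (ht : t ∈ β i) :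
    ((∑ j ∈ s, f j : R.F) : S → X) t = (f i : S → X) t := by
  rw [AddSubmonoid.coe_finsetSum, Finset.sum_apply]
  exact Finset.sum_eq_single_of_mem i hi fun j hj hji =>
    (hf j hj).eq_zero fun h => disjoint_left.1 (hβ j hj i hi hji) h ht

theorem sum_mem_FS {A : Set X} (hA : A ∈ R.B) (hfA : ∀ i ∈ s, f i ∈ R.FB A) :
    ∑ i ∈ s, f i ∈ R.FS A := by
  refine ⟨mem_FB.2 fun t => ?_, supportedBy_sum s fun i hi => (hf i hi).mono (subset_univ _)⟩
  by_cases h : ∃ i ∈ s, t ∈ β i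
  · obtain ⟨i, hi, ht⟩ := h
    rw [sum_apply_of_mem hβ hf hi ht]
    exact mem_FB.1 (hfA i hi) t
  · push Not at h
    rw [AddSubmonoid.coe_finsetSum, Finset.sum_apply,
      Finset.sum_eq_zero fun i hi => (hf i hi).eq_zero (h i hi)]
    exact R.B_zero A hA

variable [AddCommMonoid Z] [UniformSpace Z] {ℓ : R.F → Z}

theorem IsRieszIntegral.map_sum (hℓ : R.IsRieszIntegral ℓ) (hβG : ∀ i ∈ s, β i ∈ R.G) :
    ℓ (∑ i ∈ s, f i) = ∑ i ∈ s, ℓ (f i) := by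
  classical
  induction s using Finset.induction_on with
  | empty => simpa using hℓ.map_zero
  | insert i s hi ih =>
    have hm : ∀ j ∈ s, j ∈ insert i s := fun j => Finset.mem_insert_of_mem
    have hi' : i ∈ insert i s := Finset.mem_insert_self i s
    have hE : ∀ γ ∈ R.G, γ ∈ R.E := fun γ hγ =>
      MeasureTheory.self_subset_generateSetAlgebra (Or.inr hγ)
    rw [Finset.sum_insert hi, Finset.sum_insert hi, hℓ.map_add, ih]
    · exact fun j hj k hk => hβ j (hm j hj) k (hm k hk)
    · exact fun j hj => hf j (hm j hj)
    · exact fun j hj => hβG j (hm j hj)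
    · refine ⟨β i, hE _ (hβG i hi'), ⋃ j ∈ s, β j,
        hE _ (R.biUnion_mem_G s fun j hj => hβG j (hm j hj)), ?_, hf i hi', ?_⟩
      · refine disjoint_iUnion₂_right.2 fun j hj => hβ i hi' j (hm j hj) ?_
        rintro rfl
        exact hi hj
      · exact supportedBy_sum s fun j hj => (hf j (hm j hj)).mono (subset_biUnion_of_mem hj)

end DisjointSums

end Functions

/-- The partitions of unity of a Riesz system, for indexed families. -/
theorem exists_indexed_decomposition {A : Set X} (hA : A ∈ R.B) {ι : Type*} (s : Finset ι)
    {γ : ι → Set S} (hγ : ∀ i ∈ s, γ i ∈ R.G) {κ : Set S} (hκ : κ ∈ R.K)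
    (hκγ : κ ⊆ ⋃ i ∈ s, γ i) {f : R.F} (hf : f ∈ R.FB A) :
    ∃ g : ι → R.F, (∀ i ∈ s, g i ∈ R.FB A ∧ SupportedBy R.K (g i : S → X) (γ i)) ∧
      (∀ J ⊆ s, ∑ i ∈ J, g i ∈ R.FB A) ∧
      ∀ t ∈ κ, (f : S → X) t = ((∑ i ∈ s, g i : R.F) : S → X) t := by
  classical
  obtain ⟨g, h1, h2, h3⟩ := R.F_decompose A hA (s.image γ)
    (by rw [Finset.coe_image]; rintro _ ⟨i, hi, rfl⟩; exact hγ i hi) κ hκ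
    (by simpa [sUnion_image] using hκγ) f hf
  -- Several indices may carry the same set: only one representative receives its function.
  obtain ⟨r, hrs, hr⟩ := exists_subset_bijOn (s : Set ι) γ
  have hrs' : ∀ i ∈ r, i ∈ s := fun i hi => hrs hi
  have hsum : ∀ J ⊆ s, ∑ i ∈ J, (if i ∈ r then g (γ i) else 0) =
      ∑ α ∈ (J.filter (· ∈ r)).image γ, g α := by
    intro J hJ
    rw [← Finset.sum_filter, Finset.sum_image]
    intro i hi j hj h
    exact hr.injOn (Finset.mem_filter.1 hi).2 (Finset.mem_filter.1 hj).2 h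
  refine ⟨fun i => if i ∈ r then g (γ i) else 0, fun i hi => ?_, fun J hJ => ?_, fun t ht => ?_⟩
  · dsimp only
    split_ifs
    · exact h1 _ (Finset.mem_image_of_mem γ hi)
    · exact ⟨(zero_mem_FS hA).1, supportedBy_zero _⟩
  · rw [hsum J hJ]
    exact h2 _ (Finset.image_subset_image ((Finset.filter_subset _ _).trans hJ))
  · have himage : s.image γ = (s.filter (· ∈ r)).image γ := by
      refine Finset.Subset.antisymm (fun α hα => ?_)
        (Finset.image_subset_image (Finset.filter_subset (· ∈ r) s))
      obtain ⟨i, hi, rfl⟩ := Finset.mem_image.1 hα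
      obtain ⟨j, hj, hji⟩ := hr.surjOn (mem_image_of_mem γ hi)
      exact Finset.mem_image.2 ⟨j, Finset.mem_filter.2 ⟨hrs' j hj, hj⟩, hji⟩
    rw [hsum s Finset.Subset.rfl, h3 t ht, himage]

end RieszSystem

/-! ### The variation of a Riesz integral -/

namespace RieszSystem

variable {S X Z : Type*} [AddCommMonoid X] [UniformSpace X] {R : RieszSystem S X}

/-- The variation of `ℓ` over `γ`, measured by `d` and on functions with range in `A`, is at most
`ε`: adding a function supported by `γ` moves `ℓ` by at most `ε`. -/
def VariationLE (R : RieszSystem S X) (ℓ : R.F → Z) (d : Z → Z → ℝ) (A : Set X) (ε : ℝ)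
    (γ : Set S) : Prop :=
  ∀ f ∈ R.FS A, ∀ g ∈ R.FS A, SupportedBy R.K (g : S → X) γ → d (ℓ f) (ℓ (f + g)) ≤ ε

theorem VariationLE.mono {ℓ : R.F → Z} {d : Z → Z → ℝ} {A A' : Set X} {ε ε' : ℝ}
    {γ γ' : Set S} (h : R.VariationLE ℓ d A ε γ) (hA : A' ⊆ A) (hε : ε ≤ ε') (hγ : γ' ⊆ γ) :
    R.VariationLE ℓ d A' ε' γ' :=
  fun f hf g hg hgγ => (h f (FS_mono hA hf) g (FS_mono hA hg) (hgγ.mono hγ)).trans hε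

variable [AddCommMonoid Z] [UniformSpace Z] {ℓ : R.F → Z} (hℓ : R.IsRieszIntegral ℓ)
  {d : Z → Z → ℝ} (hd : IsContractivePseudometric d)

include hℓ hd in
/-- The exhaustion principle: if removing members of `K` from its members does not lead out of a
non-empty family of members of `G`, then the variation of `ℓ` over some member is small. Otherwise
one could remove one after the other the supports of functions that move `ℓ` a lot, contrary to
the `s`-boundedness of `ℓ`. -/
theorem exists_variationLE_of_exhaustion {O : Set (Set S)} (hO : O ⊆ R.G) (hne : O.Nonempty)
    (hdiff : ∀ o ∈ O, ∀ κ ∈ R.K, κ ⊆ o → o \ κ ∈ O) {A : Set X} (hA : A ∈ R.B) {ε : ℝ}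
    (hε : 0 < ε) : ∃ o ∈ O, R.VariationLE ℓ d A ε o := by
  by_contra! hcon
  have step : ∀ o : O, ∃ (o' : O) (γ : Set S), γ ∈ R.G ∧ γ ⊆ o \ o' ∧ (o' : Set S) ⊆ o ∧
      ∃ f ∈ R.FS A, ∃ g ∈ R.FS A, SupportedBy R.K (g : S → X) γ ∧ ε < d (ℓ f) (ℓ (f + g)) := by
    rintro ⟨o, ho⟩
    have h := hcon o ho
    simp only [VariationLE, not_forall, not_le] at h
    obtain ⟨f, hf, g, hg, ⟨κ, hκ, hκo, hgκ⟩, h⟩ := h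
    obtain ⟨γ, hγ, κ', hκ', h1, h2, h3⟩ := R.interpolate κ hκ o (hO ho) hκo
    refine ⟨⟨o \ κ', hdiff o ho κ' hκ' h3⟩, γ, hγ, ?_, sdiff_subset, f, hf, g, hg,
      ⟨κ, hκ, h1, hgκ⟩, h⟩
    intro t ht
    exact ⟨h3 (h2 ht), fun h => h.2 (h2 ht)⟩
  choose next γ hγG hγ hnext hbad using step
  obtain ⟨o₀, ho₀⟩ := hne
  let o : ℕ → O := fun n => Nat.rec ⟨o₀, ho₀⟩ (fun _ o => next o) n
  have hanti : Antitone fun n => (o n).1 := antitone_nat_of_succ_le fun n _ ht => hnext (o n) ht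
  have hlt : ∀ i j, i < j → Disjoint (γ (o i)) (γ (o j)) := fun i j hij =>
    disjoint_left.2 fun t hi hj => (hγ (o i) hi).2 (hanti (Nat.succ_le_of_lt hij) (hγ (o j) hj).1)
  obtain ⟨m, hm⟩ := hℓ.sBounded A hA _ (hd.mem_uniformity ε hε) (fun n => γ (o n))
    (fun n => hγG _) (fun i j hij => hij.lt_or_gt.elim (hlt i j) fun h => (hlt j i h).symm)
  obtain ⟨f, hf, g, hg, h1, h2⟩ := hbad (o (m + 1))
  exact absurd (hm (m + 1) (Nat.lt_succ_self m) f hf.1 g hg.1 h1) h2.le.not_gt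

include hℓ hd in
/-- Inner regularity. -/
theorem exists_K_variationLE {γ : Set S} (hγ : γ ∈ R.G) {A : Set X} (hA : A ∈ R.B) {ε : ℝ}
    (hε : 0 < ε) : ∃ κ ∈ R.K, κ ⊆ γ ∧ R.VariationLE ℓ d A ε (γ \ κ) := by
  obtain ⟨_, ⟨κ, hκ, hκγ, rfl⟩, h⟩ := exists_variationLE_of_exhaustion hℓ hd
    (O := {o | ∃ κ ∈ R.K, κ ⊆ γ ∧ o = γ \ κ})
    (by rintro _ ⟨κ, hκ, -, rfl⟩; exact R.G_diff κ hκ γ hγ)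
    ⟨_, ∅, R.K_empty, empty_subset _, rfl⟩
    (by
      rintro _ ⟨κ, hκ, hκγ, rfl⟩ κ' hκ' hκ'γ
      exact ⟨κ ∪ κ', R.K_union _ hκ _ hκ', union_subset hκγ (hκ'γ.trans sdiff_subset),
        sdiff_sdiff⟩) hA hε
  exact ⟨κ, hκ, hκγ, h⟩

include hℓ hd in
/-- Outer regularity. -/
theorem exists_G_variationLE {κ : Set S} (hκ : κ ∈ R.K) {A : Set X} (hA : A ∈ R.B) {ε : ℝ}
    (hε : 0 < ε) : ∃ γ ∈ R.G, κ ⊆ γ ∧ R.VariationLE ℓ d A ε (γ \ κ) := by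
  obtain ⟨_, ⟨γ, hγ, hκγ, rfl⟩, h⟩ := exists_variationLE_of_exhaustion hℓ hd
    (O := {o | ∃ γ ∈ R.G, κ ⊆ γ ∧ o = γ \ κ})
    (by rintro _ ⟨γ, hγ, -, rfl⟩; exact R.G_diff κ hκ γ hγ)
    ⟨_, univ, R.univ_mem_G, subset_univ _, rfl⟩
    (by
      rintro _ ⟨γ, hγ, hκγ, rfl⟩ κ' hκ' hκ'γ
      exact ⟨γ \ κ', R.G_diff _ hκ' _ hγ, subset_sdiff.2 ⟨hκγ, (subset_sdiff.1 hκ'γ).2.symm⟩,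
        sdiff_right_comm _ _ _⟩) hA hε
  exact ⟨γ, hγ, hκγ, h⟩

include hℓ hd in
/-- The comparison principle: two functions supported by `γ` that are close on a neighbourhood of
`κ` have close integrals, up to the variation of `ℓ` over `γ \ κ`. -/
theorem exists_comparison {A C : Set X} (hA : A ∈ R.B) (hAC : R.Dominates A C) {ε : ℝ}
    (hε : 0 < ε) : ∃ U ∈ 𝓤 X, ∀ δ, ∀ κ ∈ R.K, ∀ γ ∈ R.G, κ ⊆ γ →
      R.VariationLE ℓ d C δ (γ \ κ) → ∀ e ∈ R.FS A, ∀ f ∈ R.FS A, ∀ g ∈ R.FS A,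
        SupportedBy R.K (f : S → X) γ → SupportedBy R.K (g : S → X) γ →
        (∃ ω ∈ R.G, κ ⊆ ω ∧ ω ⊆ γ ∧ ∀ s ∈ ω, ((f : S → X) s, (g : S → X) s) ∈ U) →
        d (ℓ (e + f)) (ℓ (e + g)) ≤ 2 * δ + ε := by
  obtain ⟨hC, h1, h2, h3⟩ := hAC
  let _ := R.T
  have : IsUniformAddMonoid R.F := R.F_uniform
  obtain ⟨D, hD, hDε⟩ : ∃ D ∈ 𝓤 R.F, ∀ f g : R.F, (f, g) ∈ D → f ∈ R.FB C → g ∈ R.FB C →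
      d (ℓ f) (ℓ g) < ε := by
    have h := hℓ.uniformContinuousOn C hC (hd.mem_uniformity ε hε)
    rw [mem_map, mem_inf_principal] at h
    exact ⟨_, h, fun f g hfg hf hg => hfg ⟨hf, hg⟩⟩
  obtain ⟨V, hV, -, hVD⟩ := exists_entourage_add_mem hD
  obtain ⟨U, hU, hUV⟩ := R.F_extend A hA V hV
  refine ⟨U, hU, fun δ κ hκ γ hγ hκγ hvar e he f hf g hg hfγ hgγ hfg => ?_⟩
  obtain ⟨p, q, hp, hq, hpγ, hqγ, hpq⟩ := hUV κ hκ γ hγ hκγ f g hf.1 hg.1 hfγ hgγ hfg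
  have hp' := mem_FS hp hpγ
  have hq' := mem_FS hq hqγ
  have h3' : ∀ f ∈ R.FS A, ∀ p ∈ R.FS A, e + (f + p) ∈ R.FB C := fun f hf p hp =>
    mem_FB.2 fun t => by
      rw [← add_assoc]
      exact h3 _ (mem_FB.1 he.1 t) _ (mem_FB.1 hf.1 t) _ (mem_FB.1 hp.1 t)
  have hclose := hDε (e + (f + p)) (e + (g + q))
    (hVD _ _ _ _ (refl_mem_uniformity hV) hpq) (h3' f hf p hp') (h3' g hg q hq')
  have hf1 := hvar _ (add_mem_FS h2 he hf) _ (FS_mono h1 hp') hpγ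
  have hg1 := hvar _ (add_mem_FS h2 he hg) _ (FS_mono h1 hq') hqγ
  rw [add_assoc] at hf1 hg1
  have t1 := hd.triangle (ℓ (e + f)) (ℓ (e + (f + p))) (ℓ (e + g))
  have t2 := hd.triangle (ℓ (e + (f + p))) (ℓ (e + (g + q))) (ℓ (e + g))
  rw [hd.symm (ℓ (e + (g + q))) (ℓ (e + g))] at t2
  linarith

include hℓ hd in
/-- The variation of `ℓ` is finitely subadditive, at the price of a larger bounded set, which does
not depend on the number of sets. -/
theorem variationLE_biUnion {A C : Set X} (hA : A ∈ R.B) (hAC : R.Dominates A C)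
    {ι : Type*} {s : Finset ι} {γ : ι → Set S} {ε : ι → ℝ}
    (hγ : ∀ i ∈ s, γ i ∈ R.G) (hvar : ∀ i ∈ s, R.VariationLE ℓ d C (ε i) (γ i)) :
    R.VariationLE ℓ d A (∑ i ∈ s, ε i) (⋃ i ∈ s, γ i) := by
  classical
  intro f hf g hg hgγ
  refine le_of_forall_pos_le_add fun η hη => ?_
  obtain ⟨U, hU, hUcomp⟩ := exists_comparison hℓ hd hA hAC (ε := η / 3) (by linarith)
  obtain ⟨κ, hκ, hκγ, hgκ⟩ := hgγ
  obtain ⟨β, hβ, hκβ, hβvar⟩ := exists_G_variationLE hℓ hd hκ hAC.mem (ε := η / 3) (by linarith)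
  have hβγ : ∀ i ∈ s, β ∩ γ i ∈ R.G := fun i hi => R.G_inter _ hβ _ (hγ i hi)
  have hκβγ : κ ⊆ ⋃ i ∈ s, β ∩ γ i := by
    intro t ht
    obtain ⟨i, hi, hti⟩ := mem_iUnion₂.1 (hκγ ht)
    exact mem_biUnion hi ⟨hκβ ht, hti⟩
  obtain ⟨ω, hω, κ', hκ', hκω, hωκ', hκ'β⟩ :=
    R.interpolate κ hκ _ (R.biUnion_mem_G s hβγ) hκβγ
  obtain ⟨φ, hφ, hφJ, hφκ'⟩ := R.exists_indexed_decomposition hA s hβγ hκ' hκ'β hg.1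
  have hφβ : SupportedBy R.K ((∑ i ∈ s, φ i : R.F) : S → X) β :=
    supportedBy_sum s fun i hi => (hφ i hi).2.mono inter_subset_left
  have hφS : ∀ J ⊆ s, ∑ i ∈ J, φ i ∈ R.FS A := fun J hJ =>
    ⟨hφJ J hJ, supportedBy_sum J fun i hi => (hφ i (hJ hi)).2.mono (subset_univ _)⟩
  have hcmp := hUcomp (η / 3) κ hκ β hβ hκβ hβvar f hf _ (hφS s Finset.Subset.rfl) g hg hφβ
    ⟨κ, hκ, hκβ, hgκ⟩ ⟨ω, hω, hκω, hωκ'.trans (hκ'β.trans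
      (iUnion₂_subset fun i _ => inter_subset_left)), fun t ht => by
        rw [hφκ' t (hωκ' ht)]; exact refl_mem_uniformity hU⟩
  have hsum : ∀ J ⊆ s, d (ℓ f) (ℓ (f + ∑ i ∈ J, φ i)) ≤ ∑ i ∈ J, ε i := by
    intro J
    induction J using Finset.induction_on with
    | empty => simp [hd.self]
    | insert i J hi ih =>
      intro hJ
      rw [Finset.insert_subset_iff] at hJ
      rw [Finset.sum_insert hi, Finset.sum_insert hi, add_comm (φ i), ← add_assoc]
      have hstep := hvar i hJ.1 _ (add_mem_FS hAC.add hf (hφS J hJ.2)) (φ i)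
        (FS_mono hAC.subset (mem_FS (hφ i hJ.1).1 (hφ i hJ.1).2)) ((hφ i hJ.1).2.mono inter_subset_right)
      have := hd.triangle (ℓ f) (ℓ (f + ∑ i ∈ J, φ i)) (ℓ (f + ∑ i ∈ J, φ i + φ i))
      have := ih hJ.2
      linarith
  have := hsum s Finset.Subset.rfl
  have := hd.triangle (ℓ f) (ℓ (f + ∑ i ∈ s, φ i)) (ℓ (f + g))
  linarith

include hℓ hd in
/-- The variation of `ℓ` tends to `0` along a sequence `o` in `G` whose members are disjoint up to
sets of small variation. -/
theorem exists_variationLE_of_almost_disjoint {A C : Set X} (hA : A ∈ R.B)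
    (hAC : R.Dominates A C) {ε : ℝ} (hε : 0 < ε) {o e : ℕ → Set S} {c : ℕ → ℝ}
    (ho : ∀ n, o n ∈ R.G) (he : ∀ n, e n ∈ R.G) (hvar : ∀ n, R.VariationLE ℓ d C (c n) (e n))
    (hc : ∀ n, ∑ j ∈ Finset.range n, c j ≤ ε)
    (hoe : ∀ i n, i < n → o i ∩ o n ⊆ ⋃ j ∈ Finset.range (n + 1), e j) :
    ∃ m, ∀ n > m, R.VariationLE ℓ d A (3 * ε) (o n) := by
  have hC := hAC.mem
  have key : ∀ n, ∃ κ ω κ', R.VariationLE ℓ d C ε (o n \ κ) ∧ ω ∈ R.G ∧ κ ∈ R.K ∧ κ' ∈ R.K ∧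
      κ ⊆ ω ∧ ω ⊆ κ' ∧ κ' ⊆ o n := by
    intro n
    obtain ⟨κ, hκ, hκo, h⟩ := exists_K_variationLE hℓ hd (ho n) hC hε
    obtain ⟨ω, hω, κ', hκ', h1, h2, h3⟩ := R.interpolate κ hκ _ (ho n) hκo
    exact ⟨κ, ω, κ', h, hω, hκ, hκ', h1, h2, h3⟩
  choose κ ω κ' h hω hκ hκ' h1 h2 h3 using key
  have hlt : ∀ i j, i < j → Disjoint (ω i \ ⋃ k ∈ Finset.range i, κ' k)
      (ω j \ ⋃ k ∈ Finset.range j, κ' k) := fun i j hij =>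
    disjoint_left.2 fun t hi hj => hj.2 (mem_biUnion (Finset.mem_range.2 hij) (h2 i hi.1))
  have hG : ∀ n, ω n \ ⋃ k ∈ Finset.range n, κ' k ∈ R.G := fun n =>
    R.G_diff _ (R.biUnion_mem_K _ fun k _ => hκ' k) _ (hω n)
  obtain ⟨m, hm⟩ := hℓ.sBounded C hC _ (hd.mem_uniformity ε hε)
    (fun n => ω n \ ⋃ k ∈ Finset.range n, κ' k) hG
    (fun i j hij => hij.lt_or_gt.elim (hlt i j) fun h => (hlt j i h).symm)
  refine ⟨m, fun n hn => ?_⟩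
  -- `o n` is covered by the `n`-th member of a disjoint sequence, the set of small variation
  -- `o n \ κ n`, and the sets `e j` for `j ≤ n`.
  let γ : ℕ → Set S
    | 0 => ω n \ ⋃ k ∈ Finset.range n, κ' k
    | 1 => o n \ κ n
    | j + 2 => e j
  let c' : ℕ → ℝ
    | 0 => ε
    | 1 => ε
    | j + 2 => c j
  have hu := variationLE_biUnion hℓ hd hA hAC (s := Finset.range (n + 1 + 2)) (γ := γ)
    (ε := c') (by
      rintro (_ | _ | j) -
      exacts [hG n, R.G_diff _ (hκ n) _ (ho n), he j]) (by
      rintro (_ | _ | j) -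
      · exact fun f hf g hg hgγ => (hm n hn f hf.1 g hg.1 hgγ).le
      · exact h n
      · exact hvar j)
  refine hu.mono Subset.rfl ?_ ?_
  · rw [Finset.sum_range_succ', Finset.sum_range_succ']
    have := hc (n + 1)
    simp only [c']
    linarith
  · intro t ht
    by_cases htκ : t ∈ κ n
    · by_cases hte : t ∈ ⋃ k ∈ Finset.range n, κ' k
      · obtain ⟨i, hi, hti⟩ := mem_iUnion₂.1 hte
        obtain ⟨j, hj, htj⟩ := mem_iUnion₂.1 (hoe i n (Finset.mem_range.1 hi) ⟨h3 i hti, ht⟩)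
        refine mem_biUnion (x := j + 2) ?_ htj
        have := Finset.mem_range.1 hj
        simp only [Finset.coe_range, mem_Iio]
        omega
      · have h0 : t ∈ γ 0 := mem_sdiff _ |>.2 ⟨h1 n htκ, hte⟩
        exact mem_iUnion₂.2 ⟨0, by simp, h0⟩
    · have h0 : t ∈ γ 1 := mem_sdiff _ |>.2 ⟨ht, htκ⟩
      exact mem_iUnion₂.2 ⟨1, by simp, h0⟩

theorem sum_geometric_le {ε : ℝ} (hε : 0 ≤ ε) (n : ℕ) :
    ∑ j ∈ Finset.range n, ε / 2 / 2 ^ j ≤ ε := by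
  have h := sum_le_hasSum (Finset.range n) (fun j _ => by positivity) (hasSum_geometric_two' ε)
  simpa using h

include hℓ hd in
/-- Every set has a neighbourhood that differs little from all smaller neighbourhoods. -/
theorem exists_G_forall_variationLE (α : Set S) {A : Set X} (hA : A ∈ R.B) {ε : ℝ} (hε : 0 < ε) :
    ∃ γ ∈ R.G, α ⊆ γ ∧ ∀ γ' ∈ R.G, α ⊆ γ' → γ' ⊆ γ →
      ∃ κ ∈ R.K, κ ⊆ γ' ∧ R.VariationLE ℓ d A ε (γ \ κ) := by
  by_contra! hcon
  have step : ∀ γ : {γ // γ ∈ R.G ∧ α ⊆ γ}, ∃ γ' : {γ // γ ∈ R.G ∧ α ⊆ γ}, γ'.1 ⊆ γ.1 ∧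
      ∀ κ ∈ R.K, κ ⊆ γ'.1 → ¬ R.VariationLE ℓ d A ε (γ.1 \ κ) := by
    rintro ⟨γ, hγ, hαγ⟩
    obtain ⟨γ', hγ', h1, h2, h3⟩ := hcon γ hγ hαγ
    exact ⟨⟨γ', hγ', h1⟩, h2, h3⟩
  choose next hnext hbad using step
  let γ : ℕ → {γ // γ ∈ R.G ∧ α ⊆ γ} :=
    fun n => Nat.rec ⟨univ, R.univ_mem_G, subset_univ _⟩ (fun _ γ => next γ) n
  have hanti : Antitone fun n => (γ n).1 := antitone_nat_of_succ_le fun n _ ht => hnext (γ n) ht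
  obtain ⟨C, hAC⟩ := R.exists_dominates hA
  have key : ∀ n : ℕ, ∃ κ ∈ R.K, κ ⊆ (γ n).1 ∧
      R.VariationLE ℓ d C (ε / 3 / 2 / 2 ^ n) ((γ n).1 \ κ) := fun n =>
    exists_K_variationLE hℓ hd (γ n).2.1 hAC.mem (by positivity)
  choose κ hκ hκγ hvar using key
  obtain ⟨m, hm⟩ := exists_variationLE_of_almost_disjoint hℓ hd hA hAC (ε := ε / 3)
    (o := fun n => (γ n).1 \ κ (n + 1)) (by linarith) (fun n => R.G_diff _ (hκ _) _ (γ n).2.1)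
    (fun n => R.G_diff _ (hκ _) _ (γ n).2.1) hvar (sum_geometric_le (by linarith)) (by
      intro i n hin t ht
      exact mem_biUnion (x := i + 1) (by simpa using hin) ⟨hanti (Nat.succ_le_of_lt hin) ht.2.1,
        ht.1.2⟩)
  refine hbad (γ (m + 1)) (κ (m + 2)) (hκ _) (hκγ (m + 2)) ?_
  exact (hm (m + 1) (Nat.lt_succ_self m)).mono Subset.rfl (by linarith) Subset.rfl

end RieszSystem

/-! ### The limits that define `τ`, `ξ` and `ν` -/

namespace RieszSystem

variable {S X Z : Type*} [AddCommMonoid X] [UniformSpace X] {R : RieszSystem S X}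

instance (γ : Set S) : Nonempty (KBelow R.K γ) := ⟨⟨∅, R.K_empty, empty_subset _⟩⟩

instance (γ : Set S) : IsDirectedOrder (KBelow R.K γ) :=
  ⟨fun κ₁ κ₂ => ⟨⟨κ₁.1 ∪ κ₂.1, R.K_union _ κ₁.2.1 _ κ₂.2.1, union_subset κ₁.2.2 κ₂.2.2⟩,
    subset_union_left (s := κ₁.1), subset_union_right (s := κ₁.1)⟩⟩

instance (α : Set S) : Nonempty (GAbove R.G α) := ⟨⟨univ, R.univ_mem_G, subset_univ _⟩⟩

instance (α : Set S) : IsCodirectedOrder (GAbove R.G α) :=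
  ⟨fun γ₁ γ₂ => ⟨⟨γ₁.1 ∩ γ₂.1, R.G_inter _ γ₁.2.1 _ γ₂.2.1, subset_inter γ₁.2.2 γ₂.2.2⟩,
    inter_subset_left (s := γ₁.1), inter_subset_right (s := γ₁.1)⟩⟩

theorem hasBasis_tauFilter (ℓ : R.F → Z) {κ : Set S} (x : X) (A : Set X) :
    (R.tauFilter ℓ κ x A).HasBasis (fun β => β ∈ R.G ∧ κ ⊆ β)
      fun β => ℓ '' R.bumps x κ β A :=
  hasBasis_biInf_principal (S := {β | β ∈ R.G ∧ κ ⊆ β})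
    (fun β₁ h₁ β₂ h₂ => ⟨β₁ ∩ β₂, ⟨R.G_inter _ h₁.1 _ h₂.1, subset_inter h₁.2 h₂.2⟩,
      image_mono (bumps_mono Subset.rfl inter_subset_left),
      image_mono (bumps_mono Subset.rfl inter_subset_right)⟩)
    ⟨univ, R.univ_mem_G, subset_univ _⟩

theorem tauFilter_neBot (ℓ : R.F → Z) {κ : Set S} (hκ : κ ∈ R.K) {A : Set X} (hA : A ∈ R.B)
    {x : X} (hx : x ∈ A) : (R.tauFilter ℓ κ x A).NeBot :=
  (hasBasis_tauFilter ℓ x A).neBot_iff.2 fun h => (bumps_nonempty hκ h.1 h.2 hA hx).image ℓ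

variable [AddCommMonoid Z] [UniformSpace Z] {ℓ : R.F → Z}

/-- Functions that equal `x` over `κ` and are supported by `γ` have close integrals if the
variation of `ℓ` over `γ \ κ` is small. -/
theorem dist_bumps_le (hℓ : R.IsRieszIntegral ℓ) {d : Z → Z → ℝ}
    (hd : IsContractivePseudometric d) {A C : Set X} (hA : A ∈ R.B) (hAC : R.Dominates A C)
    {ε : ℝ} {κ γ : Set S} (hκ : κ ∈ R.K) (hγ : γ ∈ R.G) (hκγ : κ ⊆ γ)
    (hvar : R.VariationLE ℓ d C ε (γ \ κ)) {x : X} {f g : R.F} (hf : f ∈ R.bumps x κ γ A)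
    (hg : g ∈ R.bumps x κ γ A) : d (ℓ f) (ℓ g) ≤ 2 * ε := by
  refine le_of_forall_pos_le_add fun η hη => ?_
  obtain ⟨U, hU, h⟩ := exists_comparison hℓ hd hA hAC hη
  obtain ⟨-, ⟨ω, hω, h1, h2⟩, h3⟩ := id hf
  obtain ⟨-, ⟨ω', hω', h1', h2'⟩, h3'⟩ := id hg
  have := h ε κ hκ γ hγ hκγ hvar 0 (zero_mem_FS hA) f (bumps_subset_FS hf) g (bumps_subset_FS hg)
    h3 h3' ⟨ω ∩ ω' ∩ γ, R.G_inter _ (R.G_inter _ hω _ hω') _ hγ,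
      subset_inter (subset_inter h1 h1') hκγ, inter_subset_right, fun t ht => by
        rw [h2 t ht.1.1, h2' t ht.1.2]; exact refl_mem_uniformity hU⟩
  simpa using this

variable [IsUniformAddMonoid Z]

theorem exists_tauFilter_le_nhds (hℓ : R.IsRieszIntegral ℓ) {κ : Set S} (hκ : κ ∈ R.K)
    {A : Set X} (hA : A ∈ R.B) {x : X} (hx : x ∈ A) : ∃ z, R.tauFilter ℓ κ x A ≤ 𝓝 z := by
  have := tauFilter_neBot ℓ hκ hA hx
  have hb := hasBasis_tauFilter ℓ (κ := κ) x A
  refine exists_le_nhds_of_isComplete (hℓ.relativelyComplete A hA) ?_ fun d hd ε hε => ?_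
  · exact mem_of_superset (hb.mem_of_mem ⟨R.univ_mem_G, subset_univ _⟩)
      ((image_mono fun _ hf => hf.1).trans subset_closure)
  · obtain ⟨C, hAC⟩ := R.exists_dominates hA
    obtain ⟨γ, hγ, hκγ, hvar⟩ := exists_G_variationLE hℓ hd hκ hAC.mem (half_pos hε)
    obtain ⟨f, hf⟩ := bumps_nonempty hκ hγ hκγ hA hx
    refine ⟨ℓ f, mem_of_superset (hb.mem_of_mem ⟨hγ, hκγ⟩) ?_⟩
    rintro _ ⟨g, hg, rfl⟩
    have := dist_bumps_le hℓ hd hA hAC hκ hγ hκγ hvar hf hg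
    rwa [mul_div_cancel₀ _ two_ne_zero] at this

variable [T2Space Z]

theorem tauFilter_le_nhds_tau (hℓ : R.IsRieszIntegral ℓ) {κ : Set S} (hκ : κ ∈ R.K)
    {A : Set X} (hA : A ∈ R.B) {x : X} (hx : x ∈ A) :
    R.tauFilter ℓ κ x A ≤ 𝓝 (R.tau ℓ κ x) := by
  obtain ⟨z, hz⟩ := exists_tauFilter_le_nhds hℓ hκ hA hx
  have hle : R.tauFilter ℓ κ x (hull R.B x) ≤ R.tauFilter ℓ κ x A :=
    ((hasBasis_tauFilter ℓ x _).le_basis_iff (hasBasis_tauFilter ℓ x _)).2 fun β hβ =>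
      ⟨β, hβ, image_mono fun f hf => ⟨hf.1.trans (R.hull_subset hA hx), hf.2⟩⟩
  have := tauFilter_neBot ℓ hκ (R.hull_mem x) (R.mem_hull x)
  have htau : R.tau ℓ κ x = z := lim_eq (hle.trans hz)
  rwa [htau]

theorem tau_mem_closure (hℓ : R.IsRieszIntegral ℓ) {κ : Set S} (hκ : κ ∈ R.K)
    {A : Set X} (hA : A ∈ R.B) {x : X} (hx : x ∈ A) :
    R.tau ℓ κ x ∈ closure (ℓ '' R.FB A) := by
  have := tauFilter_neBot ℓ hκ hA hx
  refine mem_closure_of_tendsto (b := R.tauFilter ℓ κ x A) (f := id)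
    (tendsto_id'.2 (tauFilter_le_nhds_tau hℓ hκ hA hx))
    (mem_of_superset ((hasBasis_tauFilter ℓ x A).mem_of_mem ⟨R.univ_mem_G, subset_univ _⟩) ?_)
  exact image_mono fun _ hf => hf.1

section

variable (hℓ : R.IsRieszIntegral ℓ) {d : Z → Z → ℝ} (hd : IsContractivePseudometric d)
include hℓ hd

theorem exists_nhd_dist_tau_le {κ : Set S} (hκ : κ ∈ R.K) {A : Set X} (hA : A ∈ R.B) {x : X}
    (hx : x ∈ A) {ε : ℝ} (hε : 0 < ε) :
    ∃ β ∈ R.G, κ ⊆ β ∧ ∀ f ∈ R.bumps x κ β A, d (ℓ f) (R.tau ℓ κ x) ≤ ε := by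
  obtain ⟨β, hβ, h⟩ := (hasBasis_tauFilter ℓ x A).mem_iff.1
    (tauFilter_le_nhds_tau hℓ hκ hA hx (hd.eventually_nhds _ hε))
  exact ⟨β, hβ.1, hβ.2, fun f hf => (h (mem_image_of_mem ℓ hf)).le⟩

variable {A C : Set X} (hA : A ∈ R.B) (hAC : R.Dominates A C) {x : X} (hx : x ∈ A) {ε : ℝ}
  {κ γ : Set S} (hκ : κ ∈ R.K) (hγ : γ ∈ R.G) (hκγ : κ ⊆ γ)
  (hvar : R.VariationLE ℓ d C ε (γ \ κ)) {f : R.F} (hf : f ∈ R.bumps x κ γ A)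
include hA hAC hx hκ hγ hκγ hvar hf

theorem dist_tau_le {κ' : Set S} (hκ' : κ' ∈ R.K) (h1 : κ ⊆ κ') (h2 : κ' ⊆ γ) :
    d (ℓ f) (R.tau ℓ κ' x) ≤ 2 * ε := by
  refine le_of_forall_pos_le_add fun η hη => ?_
  obtain ⟨β, hβ, hκβ, h⟩ := exists_nhd_dist_tau_le hℓ hd hκ' hA hx hη
  obtain ⟨g, hg⟩ := bumps_nonempty hκ' (R.G_inter _ hβ _ hγ) (subset_inter hκβ h2) hA hx
  have t1 := h g (bumps_mono Subset.rfl inter_subset_left hg)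
  have t2 := dist_bumps_le hℓ hd hA hAC hκ hγ hκγ hvar hf (bumps_mono h1 inter_subset_right hg)
  have := hd.triangle (ℓ f) (ℓ g) (R.tau ℓ κ' x)
  linarith

end

theorem tendsto_tau (hℓ : R.IsRieszIntegral ℓ) {γ : Set S} (hγ : γ ∈ R.G) :
    Tendsto (fun κ : KBelow R.K γ => R.tau ℓ κ.1) atTop (𝓝 (R.xi ℓ γ)) := by
  refine tendsto_nhds_limUnder (?_ : ∃ z, _)
  have key : ∀ x, ∃ z, Tendsto (fun κ : KBelow R.K γ => R.tau ℓ κ.1 x) atTop (𝓝 z) := by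
    intro x
    have hA := R.hull_mem x
    have hx := R.mem_hull x
    refine exists_le_nhds_of_isComplete (hℓ.relativelyComplete _ hA) ?_ fun d hd ε hε => ?_
    · exact mem_map.2 (univ_mem' fun κ => tau_mem_closure hℓ κ.2.1 hA hx)
    · obtain ⟨C, hAC⟩ := R.exists_dominates hA
      obtain ⟨κ, hκ, hκγ, hvar⟩ := exists_K_variationLE hℓ hd hγ hAC.mem (half_pos hε)
      obtain ⟨f, hf⟩ := bumps_nonempty hκ hγ hκγ hA hx
      refine ⟨ℓ f, eventually_map.2 ?_⟩
      filter_upwards [eventually_ge_atTop (⟨κ, hκ, hκγ⟩ : KBelow R.K γ)] with κ' hκ'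
      have := dist_tau_le hℓ hd hA hAC hx hκ hγ hκγ hvar hf κ'.2.1 hκ' κ'.2.2
      rwa [mul_div_cancel₀ _ two_ne_zero] at this
  choose z hz using key
  exact ⟨z, tendsto_pi_nhds.2 hz⟩

theorem xi_mem_closure (hℓ : R.IsRieszIntegral ℓ) {γ : Set S} (hγ : γ ∈ R.G)
    {A : Set X} (hA : A ∈ R.B) {x : X} (hx : x ∈ A) :
    R.xi ℓ γ x ∈ closure (ℓ '' R.FB A) :=
  isClosed_closure.mem_of_tendsto (tendsto_pi_nhds.1 (tendsto_tau hℓ hγ) x)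
    (univ_mem' fun κ => tau_mem_closure hℓ κ.2.1 hA hx)

section

variable (hℓ : R.IsRieszIntegral ℓ) {d : Z → Z → ℝ} (hd : IsContractivePseudometric d)
  {A C : Set X} (hA : A ∈ R.B) (hAC : R.Dominates A C) {x : X} (hx : x ∈ A) {ε : ℝ}
  {κ γ : Set S} (hκ : κ ∈ R.K) (hγ : γ ∈ R.G) (hκγ : κ ⊆ γ)
  (hvar : R.VariationLE ℓ d C ε (γ \ κ)) {f : R.F} (hf : f ∈ R.bumps x κ γ A)
include hℓ hd hA hAC hx hκ hγ hκγ hvar hf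

theorem dist_xi_le {γ' : Set S} (hγ' : γ' ∈ R.G) (h1 : κ ⊆ γ') (h2 : γ' ⊆ γ) :
    d (ℓ f) (R.xi ℓ γ' x) ≤ 2 * ε := by
  refine hd.le_of_tendsto (tendsto_pi_nhds.1 (tendsto_tau hℓ hγ') x) ?_
  filter_upwards [eventually_ge_atTop (⟨κ, hκ, h1⟩ : KBelow R.K γ')] with κ' hκ'
  exact dist_tau_le hℓ hd hA hAC hx hκ hγ hκγ hvar hf κ'.2.1 hκ' (κ'.2.2.trans h2)

end

theorem tendsto_xi (hℓ : R.IsRieszIntegral ℓ) (α : Set S) :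
    Tendsto (fun γ : GAbove R.G α => R.xi ℓ γ.1) atBot (𝓝 (R.nu ℓ α)) := by
  refine tendsto_nhds_limUnder (?_ : ∃ z, _)
  have key : ∀ x, ∃ z, Tendsto (fun γ : GAbove R.G α => R.xi ℓ γ.1 x) atBot (𝓝 z) := by
    intro x
    have hA := R.hull_mem x
    have hx := R.mem_hull x
    refine exists_le_nhds_of_isComplete (hℓ.relativelyComplete _ hA) ?_ fun d hd ε hε => ?_
    · exact mem_map.2 (univ_mem' fun γ => xi_mem_closure hℓ γ.2.1 hA hx)
    · obtain ⟨C, hAC⟩ := R.exists_dominates hA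
      obtain ⟨γ, hγ, hαγ, h⟩ := exists_G_forall_variationLE hℓ hd α hAC.mem
        (show 0 < ε / 4 by linarith)
      refine ⟨R.xi ℓ γ x, eventually_map.2 ?_⟩
      filter_upwards [eventually_le_atBot (⟨γ, hγ, hαγ⟩ : GAbove R.G α)] with γ' hγ'
      obtain ⟨κ, hκ, hκγ', hvar⟩ := h γ'.1 γ'.2.1 γ'.2.2 hγ'
      have hκγ : κ ⊆ γ := hκγ'.trans hγ'
      obtain ⟨f, hf⟩ := bumps_nonempty hκ hγ hκγ hA hx
      have t1 := dist_xi_le hℓ hd hA hAC hx hκ hγ hκγ hvar hf γ'.2.1 hκγ' hγ'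
      have t2 := dist_xi_le hℓ hd hA hAC hx hκ hγ hκγ hvar hf hγ hκγ Subset.rfl
      have t3 := hd.triangle (R.xi ℓ γ x) (ℓ f) (R.xi ℓ γ'.1 x)
      rw [hd.symm] at t2
      linarith
  choose z hz using key
  exact ⟨z, tendsto_pi_nhds.2 hz⟩

section

variable (hℓ : R.IsRieszIntegral ℓ) {d : Z → Z → ℝ} (hd : IsContractivePseudometric d)
  {A C : Set X} (hA : A ∈ R.B) (hAC : R.Dominates A C) {x : X} (hx : x ∈ A) {ε : ℝ}
  {κ γ : Set S} (hκ : κ ∈ R.K) (hγ : γ ∈ R.G) (hκγ : κ ⊆ γ)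
  (hvar : R.VariationLE ℓ d C ε (γ \ κ))
include hℓ hd hA hAC hx hκ hγ hκγ hvar

theorem dist_nu_le {f : R.F} (hf : f ∈ R.bumps x κ γ A) {α : Set S} (h1 : κ ⊆ α) (h2 : α ⊆ γ) :
    d (ℓ f) (R.nu ℓ α x) ≤ 2 * ε := by
  refine hd.le_of_tendsto (tendsto_pi_nhds.1 (tendsto_xi hℓ α) x) ?_
  filter_upwards [eventually_le_atBot (⟨γ, hγ, h2⟩ : GAbove R.G α)] with γ' hγ'
  exact dist_xi_le hℓ hd hA hAC hx hκ hγ hκγ hvar hf γ'.2.1 (h1.trans γ'.2.2) hγ'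

theorem dist_tau_nu_le {α : Set S} (h1 : κ ⊆ α) (h2 : α ⊆ γ) :
    d (R.tau ℓ κ x) (R.nu ℓ α x) ≤ 4 * ε := by
  obtain ⟨f, hf⟩ := bumps_nonempty hκ hγ hκγ hA hx
  have t1 := dist_nu_le hℓ hd hA hAC hx hκ hγ hκγ hvar hf h1 h2
  have t2 := dist_tau_le hℓ hd hA hAC hx hκ hγ hκγ hvar hf hκ Subset.rfl hκγ
  have t3 := hd.triangle (R.tau ℓ κ x) (ℓ f) (R.nu ℓ α x)
  rw [hd.symm] at t2
  linarith

end

theorem nu_eq_tau (hℓ : R.IsRieszIntegral ℓ) {κ : Set S} (hκ : κ ∈ R.K) :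
    R.nu ℓ κ = R.tau ℓ κ := by
  ext x
  refine (eq_of_forall_pseudometric fun d hd ε hε => ?_).symm
  obtain ⟨C, hAC⟩ := R.exists_dominates (R.hull_mem x)
  obtain ⟨γ, hγ, hκγ, hvar⟩ := exists_G_variationLE hℓ hd hκ hAC.mem
    (show 0 < ε / 4 by linarith)
  have := dist_tau_nu_le hℓ hd (R.hull_mem x) hAC (R.mem_hull x) hκ hγ hκγ hvar Subset.rfl hκγ
  linarith

theorem nu_eq_xi (hℓ : R.IsRieszIntegral ℓ) {γ : Set S} (hγ : γ ∈ R.G) :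
    R.nu ℓ γ = R.xi ℓ γ := by
  refine tendsto_nhds_unique (tendsto_xi hℓ γ) (tendsto_const_nhds.congr' ?_)
  filter_upwards [eventually_le_atBot (⟨γ, hγ, Subset.rfl⟩ : GAbove R.G γ)] with γ' hγ'
  rw [show γ'.1 = γ from Subset.antisymm hγ' γ'.2.2]

theorem nu_empty (hℓ : R.IsRieszIntegral ℓ) : R.nu ℓ ∅ = 0 := by
  rw [nu_eq_tau hℓ R.K_empty]
  ext x
  have hA := R.hull_mem x
  have hx := R.mem_hull x
  have := tauFilter_neBot ℓ R.K_empty hA hx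
  have h0 : R.tauFilter ℓ ∅ x (hull R.B x) ≤ 𝓝 0 := by
    refine le_trans (le_pure_iff.2 ?_) (pure_le_nhds 0)
    refine mem_of_superset ((hasBasis_tauFilter ℓ x _).mem_of_mem ⟨R.G_empty, Subset.rfl⟩) ?_
    rintro _ ⟨f, hf, rfl⟩
    have : f = 0 := by
      ext t
      exact hf.2.2.eq_zero (notMem_empty t)
    rw [this, hℓ.map_zero]
    rfl
  exact lim_eq h0

end RieszSystem

/-! ### Sums over disjoint families and the variation of the measure -/

theorem sum_div_card_succ_le {ι : Type*} (s : Finset ι) {ε : ℝ} (hε : 0 ≤ ε) :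
    ∑ _i ∈ s, ε / (s.card + 1) ≤ ε := by
  rw [Finset.sum_const, nsmul_eq_mul, ← mul_div_assoc, div_le_iff₀ (by positivity)]
  nlinarith

/-- A sum over a finite indexed family of disjoint sets, to which the empty set does not contribute,
can be indexed by the sets themselves. -/
theorem exists_finset_sum_eq {S M ι : Type*} [AddCommMonoid M] [Nonempty ι] (s : Finset ι)
    {κ : ι → Set S} (hκ : ∀ i ∈ s, ∀ j ∈ s, i ≠ j → Disjoint (κ i) (κ j)) :
    ∃ (P : Finset (Set S)) (r : Set S → ι), (∀ ρ ∈ P, r ρ ∈ s ∧ κ (r ρ) = ρ) ∧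
      (P : Set (Set S)).PairwiseDisjoint id ∧
      ∀ φ : Set S → ι → M, (∀ i, φ ∅ i = 0) → ∑ i ∈ s, φ (κ i) i = ∑ ρ ∈ P, φ ρ (r ρ) := by
  classical
  set s' := s.filter fun i => (κ i).Nonempty with hs'
  have hinj : InjOn κ s' := by
    intro i hi j hj hij
    by_contra hne
    obtain ⟨hi, t, ht⟩ := Finset.mem_filter.1 hi
    exact disjoint_left.1 (hκ i hi j (Finset.mem_filter.1 hj).1 hne) ht (hij ▸ ht)
  have hr : ∀ i ∈ s', Function.invFunOn κ s' (κ i) = i := fun i hi => hinj.leftInvOn_invFunOn hi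
  refine ⟨s'.image κ, Function.invFunOn κ s', ?_, ?_, fun φ hφ => ?_⟩
  · intro ρ hρ
    obtain ⟨i, hi, rfl⟩ := Finset.mem_image.1 hρ
    rw [hr i hi]
    exact ⟨(Finset.mem_filter.1 hi).1, rfl⟩
  · intro ρ hρ ρ' hρ' hne
    obtain ⟨i, hi, rfl⟩ := Finset.mem_image.1 (Finset.mem_coe.1 hρ)
    obtain ⟨j, hj, rfl⟩ := Finset.mem_image.1 (Finset.mem_coe.1 hρ')
    exact hκ i (Finset.mem_filter.1 hi).1 j (Finset.mem_filter.1 hj).1 fun h => hne (h ▸ rfl)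
  · have hsum : ∑ i ∈ s', φ (κ i) i = ∑ i ∈ s, φ (κ i) i :=
      Finset.sum_filter_of_ne fun i _ h => nonempty_iff_ne_empty.2 fun h0 => h (h0 ▸ hφ i)
    rw [Finset.sum_image hinj, ← hsum]
    exact Finset.sum_congr rfl fun i hi => by rw [hr i hi]

namespace RieszSystem

variable {S X Z : Type*} [AddCommMonoid X] [UniformSpace X] {R : RieszSystem S X}

theorem exists_bumps_family {A : Set X} (hA : A ∈ R.B) {ι : Type*} {s : Finset ι}
    {κ β : ι → Set S} (hκ : ∀ i ∈ s, κ i ∈ R.K) (hβ : ∀ i ∈ s, β i ∈ R.G)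
    (hκβ : ∀ i ∈ s, κ i ⊆ β i) {x : ι → X} (hx : ∀ i ∈ s, x i ∈ A) :
    ∃ f : ι → R.F, ∀ i ∈ s, f i ∈ R.bumps (x i) (κ i) (β i) A := by
  have : ∀ i, ∃ f, i ∈ s → f ∈ R.bumps (x i) (κ i) (β i) A := fun i => by
    by_cases hi : i ∈ s
    · obtain ⟨f, hf⟩ := bumps_nonempty (hκ i hi) (hβ i hi) (hκβ i hi) hA (hx i hi)
      exact ⟨f, fun _ => hf⟩
    · exact ⟨0, fun h => absurd h hi⟩
  choose f hf using this
  exact ⟨f, hf⟩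

variable [AddCommMonoid Z] [UniformSpace Z] {ℓ : R.F → Z}

section

variable (hℓ : R.IsRieszIntegral ℓ) {d : Z → Z → ℝ} (hd : IsContractivePseudometric d)
include hℓ hd

theorem variationLE_union {A C : Set X} (hA : A ∈ R.B) (hAC : R.Dominates A C) {γ γ' : Set S}
    {ε ε' : ℝ} (hγ : γ ∈ R.G) (hγ' : γ' ∈ R.G) (h : R.VariationLE ℓ d C ε γ)
    (h' : R.VariationLE ℓ d C ε' γ') : R.VariationLE ℓ d A (ε + ε') (γ ∪ γ') := by
  have := variationLE_biUnion hℓ hd hA hAC (s := (Finset.univ : Finset Bool))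
    (γ := fun b => cond b γ γ') (ε := fun b => cond b ε ε')
    (by rintro (_ | _) -; exacts [hγ', hγ]) (by rintro (_ | _) -; exacts [h', h])
  refine this.mono Subset.rfl (by simp) (union_subset (fun t ht => ?_) fun t ht => ?_)
  exacts [mem_iUnion₂.2 ⟨true, Finset.mem_univ _, ht⟩, mem_iUnion₂.2 ⟨false, Finset.mem_univ _, ht⟩]

/-- Finitely many members of `G` contain disjoint members of `K` that together nearly exhaust each
of them. -/
theorem exists_disjoint_K {ι : Type*} (s : Finset ι) {o : ι → Set S} (ho : ∀ i ∈ s, o i ∈ R.G)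
    {A : Set X} (hA : A ∈ R.B) {ε : ℝ} (hε : 0 < ε) :
    ∃ κ : ι → Set S, (∀ i ∈ s, κ i ∈ R.K) ∧ (∀ i ∈ s, κ i ⊆ o i) ∧
      (∀ i ∈ s, ∀ j ∈ s, i ≠ j → Disjoint (κ i) (κ j)) ∧
      ∀ i ∈ s, R.VariationLE ℓ d A ε (o i \ ⋃ j ∈ s, κ j) := by
  classical
  induction s using Finset.induction_on with
  | empty => exact ⟨fun _ => ∅, by simp, by simp, by simp, by simp⟩
  | insert a s ha ih =>
    have hm : ∀ j ∈ s, j ∈ insert a s := fun j => Finset.mem_insert_of_mem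
    obtain ⟨κ, hκ, hκo, hdisj, hvar⟩ := ih fun i hi => ho i (hm i hi)
    obtain ⟨κa, hκa, hκao, hvara⟩ := exists_K_variationLE hℓ hd
      (R.G_diff _ (R.biUnion_mem_K s hκ) _ (ho a (Finset.mem_insert_self a s))) hA hε
    have hne : ∀ i ∈ s, i ≠ a := fun i hi h => ha (h ▸ hi)
    have hκ' : ∀ i ∈ s, Function.update κ a κa i = κ i := fun i hi =>
      Function.update_of_ne (hne i hi) _ _
    have hU : ⋃ j ∈ insert a s, Function.update κ a κa j = κa ∪ ⋃ j ∈ s, κ j := by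
      rw [Finset.set_biUnion_insert, Function.update_self]
      congr 1
      exact iUnion₂_congr hκ'
    have hda : ∀ i ∈ s, Disjoint (κ i) κa := fun i hi =>
      (disjoint_iUnion₂_right.1 (subset_sdiff.1 hκao).2 i hi).symm
    refine ⟨Function.update κ a κa, ?_, ?_, ?_, ?_⟩
    · refine (Finset.forall_mem_insert _ _ _).2 ⟨by simpa using hκa, fun i hi => ?_⟩
      rw [hκ' i hi]
      exact hκ i hi
    · refine (Finset.forall_mem_insert _ _ _).2 ⟨?_, fun i hi => ?_⟩
      · simpa using hκao.trans sdiff_subset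
      · rw [hκ' i hi]
        exact hκo i hi
    · intro i hi j hj hij
      rcases Finset.mem_insert.1 hi with rfl | his <;> rcases Finset.mem_insert.1 hj with rfl | hjs
      · exact absurd rfl hij
      · rw [Function.update_self, hκ' j hjs]
        exact (hda j hjs).symm
      · rw [Function.update_self, hκ' i his]
        exact hda i his
      · rw [hκ' i his, hκ' j hjs]
        exact hdisj i his j hjs hij
    · rw [hU]
      refine (Finset.forall_mem_insert _ _ _).2 ⟨?_, fun i hi => ?_⟩
      · rwa [union_comm, ← sdiff_sdiff]
      · exact (hvar i hi).mono Subset.rfl le_rfl (sdiff_subset_sdiff_right subset_union_right)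

variable [IsUniformAddMonoid Z] [T2Space Z]

/-- The integral of a sum of functions that equal `x i` over disjoint `κ i` is close to
`∑ τ (κ i) (x i)` if these functions are supported by small disjoint neighbourhoods. -/
theorem exists_nhds_dist_sum_tau_le {A : Set X} (hA : A ∈ R.B) {ι : Type*} (s : Finset ι)
    {κ : ι → Set S} (hκ : ∀ i ∈ s, κ i ∈ R.K) {x : ι → X} (hx : ∀ i ∈ s, x i ∈ A) {ε : ℝ}
    (hε : 0 < ε) :
    ∃ γ : ι → Set S, (∀ i ∈ s, γ i ∈ R.G) ∧ (∀ i ∈ s, κ i ⊆ γ i) ∧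
      ∀ (β : ι → Set S) (f : ι → R.F), (∀ i ∈ s, β i ∈ R.G) → (∀ i ∈ s, β i ⊆ γ i) →
        (∀ i ∈ s, ∀ j ∈ s, i ≠ j → Disjoint (β i) (β j)) →
        (∀ i ∈ s, f i ∈ R.bumps (x i) (κ i) (β i) A) →
        d (ℓ (∑ i ∈ s, f i)) (∑ i ∈ s, R.tau ℓ (κ i) (x i)) ≤ ε := by
  have key : ∀ i, ∃ γ, i ∈ s → γ ∈ R.G ∧ κ i ⊆ γ ∧
      ∀ f ∈ R.bumps (x i) (κ i) γ A, d (ℓ f) (R.tau ℓ (κ i) (x i)) ≤ ε / (s.card + 1) := by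
    intro i
    by_cases hi : i ∈ s
    · obtain ⟨γ, h⟩ := exists_nhd_dist_tau_le hℓ hd (hκ i hi) hA (hx i hi)
        (show 0 < ε / (s.card + 1) by positivity)
      exact ⟨γ, fun _ => h⟩
    · exact ⟨∅, fun h => absurd h hi⟩
  choose γ hγ using key
  refine ⟨γ, fun i hi => (hγ i hi).1, fun i hi => (hγ i hi).2.1, fun β f hβ hβγ hdisj hf => ?_⟩
  rw [hℓ.map_sum hdisj (fun i hi => (hf i hi).2.2) hβ]
  refine (hd.sum_sum s _ _).trans ((Finset.sum_le_sum fun i hi => ?_).trans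
    (sum_div_card_succ_le s hε.le))
  exact (hγ i hi).2.2 _ (bumps_mono Subset.rfl (hβγ i hi) (hf i hi))

theorem dist_sum_tau_le_of_variationLE {A : Set X} (hA : A ∈ R.B) {ε : ℝ} {γ : Set S}
    (hγ : γ ∈ R.G) (hvar : R.VariationLE ℓ d A ε γ) {ι : Type*} {s : Finset ι} {κ : ι → Set S}
    (hκ : ∀ i ∈ s, κ i ∈ R.K) (hκγ : ∀ i ∈ s, κ i ⊆ γ)
    (hdisj : ∀ i ∈ s, ∀ j ∈ s, i ≠ j → Disjoint (κ i) (κ j)) {x y : ι → X}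
    (hx : ∀ i ∈ s, x i ∈ A) (hy : ∀ i ∈ s, y i ∈ A) :
    d (∑ i ∈ s, R.tau ℓ (κ i) (x i)) (∑ i ∈ s, R.tau ℓ (κ i) (x i + y i)) ≤ ε := by
  refine le_of_forall_pos_le_add fun η hη => ?_
  obtain ⟨C, hAC⟩ := R.exists_dominates hA
  obtain ⟨γ₁, hγ₁, hκγ₁, h₁⟩ := exists_nhds_dist_sum_tau_le hℓ hd hA s hκ hx (half_pos hη)
  obtain ⟨γ₂, hγ₂, hκγ₂, h₂⟩ := exists_nhds_dist_sum_tau_le hℓ hd hAC.mem s hκ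
    (fun i hi => hAC.add _ (hx i hi) _ (hy i hi)) (half_pos hη)
  obtain ⟨β, hβ, hκβ, hβγ, hβd⟩ := R.exists_disjoint_nhds s hκ
    (γ := fun i => γ₁ i ∩ γ₂ i ∩ γ)
    (fun i hi => R.G_inter _ (R.G_inter _ (hγ₁ i hi) _ (hγ₂ i hi)) _ hγ)
    (fun i hi => subset_inter (subset_inter (hκγ₁ i hi) (hκγ₂ i hi)) (hκγ i hi)) hdisj
  obtain ⟨f, hf⟩ := exists_bumps_family hA hκ hβ hκβ hx
  obtain ⟨g, hg⟩ := exists_bumps_family hA hκ hβ hκβ hy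
  have e₁ := h₁ β f hβ (fun i hi => (hβγ i hi).trans (inter_subset_left.trans inter_subset_left))
    hβd hf
  have e₂ := h₂ β (fun i => f i + g i) hβ
    (fun i hi => (hβγ i hi).trans (inter_subset_left.trans inter_subset_right))
    hβd fun i hi => add_mem_bumps hAC.add (hf i hi) (hg i hi)
  have e₃ := hvar _ (sum_mem_FS hβd (fun i hi => (hf i hi).2.2) hA fun i hi => (hf i hi).1)
    _ (sum_mem_FS hβd (fun i hi => (hg i hi).2.2) hA fun i hi => (hg i hi).1)
    (supportedBy_sum s fun i hi => (hg i hi).2.2.mono ((hβγ i hi).trans inter_subset_right))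
  rw [Finset.sum_add_distrib] at e₂
  have t₁ := hd.triangle (∑ i ∈ s, R.tau ℓ (κ i) (x i)) (ℓ (∑ i ∈ s, f i))
    (∑ i ∈ s, R.tau ℓ (κ i) (x i + y i))
  have t₂ := hd.triangle (ℓ (∑ i ∈ s, f i)) (ℓ (∑ i ∈ s, f i + ∑ i ∈ s, g i))
    (∑ i ∈ s, R.tau ℓ (κ i) (x i + y i))
  rw [hd.symm] at e₁
  linarith

end

end RieszSystem

/-! ### Regular sets -/

namespace RieszSystem

variable {S X Z : Type*} [AddCommMonoid X] [UniformSpace X] {R : RieszSystem S X}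
  [AddCommMonoid Z] [UniformSpace Z] {ℓ : R.F → Z}

section

variable [IsUniformAddMonoid Z] [T2Space Z]
  (hℓ : R.IsRieszIntegral ℓ) {d : Z → Z → ℝ} (hd : IsContractivePseudometric d)
include hℓ hd

/-- A function that is nearly constant, with value `x i`, on each member `o i` of a finite cover
has an integral close to `∑ τ (κ i) (x i)` if the `κ i ⊆ o i` are disjoint and the variation of `ℓ`
outside their union is small. How nearly constant it must be does not depend on the cover. -/
theorem exists_dist_sum_tau_le {A C : Set X} (hA : A ∈ R.B) (hAC : R.Dominates A C) {ε : ℝ}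
    (hε : 0 < ε) :
    ∃ U ∈ 𝓤 X, ∀ {ι : Type _} (s : Finset ι) (κ o : ι → Set S) (x : ι → X), (∀ i ∈ s, κ i ∈ R.K) →
      (∀ i ∈ s, o i ∈ R.G) → (∀ i ∈ s, κ i ⊆ o i) →
      (∀ i ∈ s, ∀ j ∈ s, i ≠ j → Disjoint (κ i) (κ j)) → (∀ i ∈ s, x i ∈ A) →
      R.VariationLE ℓ d C ε (univ \ ⋃ i ∈ s, κ i) → ∀ f ∈ R.FS A,
      (∀ i ∈ s, ∀ t ∈ o i, ((f : S → X) t, x i) ∈ U) →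
      d (ℓ f) (∑ i ∈ s, R.tau ℓ (κ i) (x i)) ≤ 4 * ε := by
  obtain ⟨U, hU, hcomp⟩ := exists_comparison hℓ hd hA hAC hε
  refine ⟨U, hU, fun s κ o x hκ ho hκo hdisj hx hvar f hf hfx => ?_⟩
  obtain ⟨γ, hγ, hκγ, h⟩ := exists_nhds_dist_sum_tau_le hℓ hd hA s hκ hx hε
  obtain ⟨β, hβ, hκβ, hβγ, hβd⟩ := R.exists_disjoint_nhds s hκ (γ := fun i => γ i ∩ o i)
    (fun i hi => R.G_inter _ (hγ i hi) _ (ho i hi))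
    (fun i hi => subset_inter (hκγ i hi) (hκo i hi)) hdisj
  obtain ⟨φ, hφ⟩ := exists_bumps_family hA hκ hβ hκβ hx
  have hφS := sum_mem_FS hβd (fun i hi => (hφ i hi).2.2) hA fun i hi => (hφ i hi).1
  have e₁ := h β φ hβ (fun i hi => (hβγ i hi).trans inter_subset_left) hβd hφ
  have key : ∀ i, ∃ ω, i ∈ s → ω ∈ R.G ∧ κ i ⊆ ω ∧ ∀ t ∈ ω, (φ i : S → X) t = x i := by
    intro i
    by_cases hi : i ∈ s
    · obtain ⟨ω, hω⟩ := (hφ i hi).2.1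
      exact ⟨ω, fun _ => hω⟩
    · exact ⟨∅, fun h => absurd h hi⟩
  choose ω hω using key
  have e₂ := hcomp ε _ (R.biUnion_mem_K s hκ) univ R.univ_mem_G (subset_univ _) hvar 0
    (zero_mem_FS hA) f hf _ hφS hf.2 hφS.2 ⟨⋃ i ∈ s, ω i ∩ β i,
      R.biUnion_mem_G s fun i hi => R.G_inter _ (hω i hi).1 _ (hβ i hi),
      iUnion₂_mono fun i hi => subset_inter (hω i hi).2.1 (hκβ i hi), subset_univ _, fun t ht => by
        obtain ⟨i, hi, ht⟩ := mem_iUnion₂.1 ht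
        rw [sum_apply_of_mem hβd (fun i hi => (hφ i hi).2.2) hi ht.2, (hω i hi).2.2 t ht.1]
        exact hfx i hi t (hβγ i hi ht.2).2⟩
  rw [zero_add, zero_add] at e₂
  have := hd.triangle (ℓ f) (ℓ (∑ i ∈ s, φ i)) (∑ i ∈ s, R.tau ℓ (κ i) (x i))
  linarith

/-- The variation of `ℓ` is determined by the values of `τ`. -/
theorem variationLE_of_dist_sum_tau_le [IsUniformAddMonoid X] {A : Set X} (hA : A ∈ R.B) {ε : ℝ}
    {γ : Set S} (hγ : γ ∈ R.G)
    (h : ∀ (s : Finset (Set S × Set S × Bool)) (κ : Set S × Set S × Bool → Set S),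
      (∀ i ∈ s, κ i ∈ R.K) → (∀ i ∈ s, κ i ⊆ γ) →
      (∀ i ∈ s, ∀ j ∈ s, i ≠ j → Disjoint (κ i) (κ j)) → ∀ x y : Set S × Set S × Bool → X,
      (∀ i ∈ s, x i ∈ A) → (∀ i ∈ s, y i ∈ A) →
      d (∑ i ∈ s, R.tau ℓ (κ i) (x i)) (∑ i ∈ s, R.tau ℓ (κ i) (x i + y i)) ≤ ε) :
    R.VariationLE ℓ d A ε γ := by
  classical
  rintro f hf g hg ⟨κg, hκg, hκgγ, hgκ⟩
  refine le_of_forall_pos_le_add fun η hη => ?_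
  obtain ⟨A₁, hA₁⟩ := R.exists_dominates hA
  obtain ⟨A₂, hA₂⟩ := R.exists_dominates hA₁.mem
  obtain ⟨A₃, hA₃⟩ := R.exists_dominates hA₂.mem
  obtain ⟨U, hU, hUf⟩ := exists_dist_sum_tau_le hℓ hd hA₁.mem hA₂ (ε := η / 8) (by positivity)
  obtain ⟨V, hV, hVU, hVadd⟩ := exists_entourage_add_mem hU
  obtain ⟨Hf, hHfG, hHf, hfV⟩ := R.F_partitionable f V hV
  obtain ⟨Hg, hHgG, hHg, hgV⟩ := R.F_partitionable g V hV
  -- The cover separates the members inside `γ` from those outside `κg`, on which `g` vanishes.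
  let s : Finset (Set S × Set S × Bool) := Hf ×ˢ Hg ×ˢ Finset.univ
  let o : Set S × Set S × Bool → Set S := fun i => i.1 ∩ i.2.1 ∩ cond i.2.2 γ (univ \ κg)
  have hs : ∀ i ∈ s, i.1 ∈ Hf ∧ i.2.1 ∈ Hg := fun i hi => by
    have := Finset.mem_product.1 hi
    exact ⟨this.1, (Finset.mem_product.1 this.2).1⟩
  have ho : ∀ i ∈ s, o i ∈ R.G := by
    intro i hi
    refine R.G_inter _ (R.G_inter _ (hHfG (hs i hi).1) _ (hHgG (hs i hi).2)) _ ?_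
    cases i.2.2
    exacts [R.G_diff _ hκg _ R.univ_mem_G, hγ]
  have hcover : ∀ t, ∃ i ∈ s, t ∈ o i := by
    intro t
    obtain ⟨a, ha, hta⟩ := mem_sUnion.1 (hHf.symm ▸ mem_univ t)
    obtain ⟨b, hb, htb⟩ := mem_sUnion.1 (hHg.symm ▸ mem_univ t)
    have hmem : ∀ c, (a, b, c) ∈ s := fun c =>
      Finset.mem_product.2 ⟨ha, Finset.mem_product.2 ⟨hb, Finset.mem_univ _⟩⟩
    by_cases ht : t ∈ κg
    · exact ⟨(a, b, true), hmem _, ⟨hta, htb⟩, hκgγ ht⟩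
    · exact ⟨(a, b, false), hmem _, ⟨hta, htb⟩, mem_univ t, ht⟩
  have hxy : ∀ i, ∃ x ∈ A, ∃ y ∈ A, i ∈ s → (i.2.2 = false → y = 0) ∧
      ∀ t ∈ o i, ((f : S → X) t, x) ∈ V ∧ ((g : S → X) t, y) ∈ V := by
    intro i
    by_cases hne : (o i).Nonempty
    · obtain ⟨t₀, ht₀⟩ := hne
      refine ⟨_, mem_FB.1 hf.1 t₀, _, mem_FB.1 hg.1 t₀, fun hi => ⟨fun hfalse => hgκ _ ?_,
        fun t ht => ⟨hfV _ (hs i hi).1 _ ht.1.1 _ ht₀.1.1, hgV _ (hs i hi).2 _ ht.1.2 _ ht₀.1.2⟩⟩⟩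
      have := ht₀.2
      rw [hfalse] at this
      exact this.2
    · exact ⟨0, R.B_zero A hA, 0, R.B_zero A hA, fun _ => ⟨fun _ => rfl, fun t ht =>
        absurd ⟨t, ht⟩ hne⟩⟩
  choose x hx y hy hxy using hxy
  obtain ⟨κ, hκ, hκo, hdisj, hvar⟩ := exists_disjoint_K hℓ hd s ho hA₃.mem
    (ε := η / 8 / (s.card + 1)) (by positivity)
  have hvar' : R.VariationLE ℓ d A₂ (η / 8) (univ \ ⋃ i ∈ s, κ i) := by
    refine (variationLE_biUnion hℓ hd hA₂.mem hA₃ (fun i hi => R.G_diff _ (R.biUnion_mem_K s hκ) _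
      (ho i hi)) hvar).mono Subset.rfl (sum_div_card_succ_le s (by positivity)) fun t ht => ?_
    obtain ⟨i, hi, hti⟩ := hcover t
    exact mem_iUnion₂.2 ⟨i, hi, hti, ht.2⟩
  have e₁ := hUf s κ o x hκ ho hκo hdisj (fun i _ => hA₁.subset (hx i)) hvar' f
    (FS_mono hA₁.subset hf) fun i hi t ht => hVU ((hxy i hi).2 t ht).1
  have e₂ := hUf s κ o (fun i => x i + y i) hκ ho hκo hdisj
    (fun i _ => hA₁.add _ (hx i) _ (hy i)) hvar' (f + g) (add_mem_FS hA₁.add hf hg)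
    fun i hi t ht => hVadd _ _ _ _ ((hxy i hi).2 t ht).1 ((hxy i hi).2 t ht).2
  have e₃ : d (∑ i ∈ s, R.tau ℓ (κ i) (x i)) (∑ i ∈ s, R.tau ℓ (κ i) (x i + y i)) ≤ ε := by
    have hout : ∑ i ∈ s with ¬ i.2.2 = true, R.tau ℓ (κ i) (x i + y i) =
        ∑ i ∈ s with ¬ i.2.2 = true, R.tau ℓ (κ i) (x i) :=
      Finset.sum_congr rfl fun i hi => by
        obtain ⟨his, hi⟩ := Finset.mem_filter.1 hi
        rw [(hxy i his).1 (by simpa using hi), add_zero]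
    rw [← Finset.sum_filter_add_sum_filter_not s (fun i => i.2.2 = true)
        (fun i => R.tau ℓ (κ i) (x i)),
      ← Finset.sum_filter_add_sum_filter_not s (fun i => i.2.2 = true)
        (fun i => R.tau ℓ (κ i) (x i + y i)), hout]
    refine (hd.add_right _ _ _).trans (h _ κ (fun i hi => hκ i (Finset.mem_filter.1 hi).1)
      (fun i hi => (hκo i (Finset.mem_filter.1 hi).1).trans fun t ht => ?_)
      (fun i hi j hj => hdisj i (Finset.mem_filter.1 hi).1 j (Finset.mem_filter.1 hj).1) x y
      (fun i _ => hx i) fun i _ => hy i)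
    have := ht.2
    rwa [(Finset.mem_filter.1 hi).2] at this
  have t₁ := hd.triangle (ℓ f) (∑ i ∈ s, R.tau ℓ (κ i) (x i)) (ℓ (f + g))
  have t₂ := hd.triangle (∑ i ∈ s, R.tau ℓ (κ i) (x i)) (∑ i ∈ s, R.tau ℓ (κ i) (x i + y i))
    (ℓ (f + g))
  rw [hd.symm] at e₂
  linarith

theorem isSmall_nu_of_variationLE {A : Set X} (hA : A ∈ R.B) {ε : ℝ} {γ : Set S} (hγ : γ ∈ R.G)
    (hvar : R.VariationLE ℓ d A ε γ) {W : Set (Z × Z)} (hW : ∀ a b, d a b ≤ ε → (a, b) ∈ W) :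
    IsSmall R.K R.G (R.nu ℓ) A W γ := by
  refine ⟨γ, hγ, Subset.rfl, fun P hP hPd hPγ x y hx hy => hW _ _ ?_⟩
  have h : ∀ z : Set S → X, ∑ κ ∈ P, R.nu ℓ κ (z κ) = ∑ κ ∈ P, R.tau ℓ κ (z κ) := fun z =>
    Finset.sum_congr rfl fun κ hκ => by rw [nu_eq_tau hℓ (hP hκ)]
  rw [h x, h fun κ => x κ + y κ]
  exact dist_sum_tau_le_of_variationLE hℓ hd hA hγ hvar (κ := fun κ => κ) (fun κ hκ => hP hκ)
    (fun κ hκ => (subset_sUnion_of_mem (Finset.mem_coe.2 hκ)).trans hPγ)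
    (fun κ hκ κ' hκ' hne => hPd hκ hκ' hne) hx hy

theorem variationLE_of_isSmall_nu [IsUniformAddMonoid X] {A : Set X} (hA : A ∈ R.B)
    {ε : ℝ} {α : Set S} (h : IsSmall R.K R.G (R.nu ℓ) A {p | d p.1 p.2 ≤ ε} α) :
    R.VariationLE ℓ d A ε α := by
  obtain ⟨γ, hγ, hαγ, h⟩ := h
  refine VariationLE.mono (γ := γ) ?_ Subset.rfl le_rfl hαγ
  refine variationLE_of_dist_sum_tau_le hℓ hd hA hγ fun s κ hκ hκγ hdisj x y hx hy => ?_
  obtain ⟨P, r, hr, hPd, hP⟩ := exists_finset_sum_eq (M := Z) s hdisj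
  have htau : ∀ x, R.tau ℓ ∅ x = 0 := fun x => by
    rw [← nu_eq_tau hℓ R.K_empty, nu_empty hℓ]
    rfl
  have hPK : ∀ ρ ∈ P, ρ ∈ R.K := fun ρ hρ => by
    rw [← (hr ρ hρ).2]
    exact hκ _ (hr ρ hρ).1
  have hsum : ∀ z : _ → X, ∑ i ∈ s, R.tau ℓ (κ i) (z i) = ∑ ρ ∈ P, R.nu ℓ ρ (z (r ρ)) := fun z => by
    rw [hP (fun ρ i => R.tau ℓ ρ (z i)) fun i => htau _]
    exact Finset.sum_congr rfl fun ρ hρ => by rw [nu_eq_tau hℓ (hPK ρ hρ)]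
  rw [hsum x, hsum fun i => x i + y i]
  refine h P (fun ρ hρ => hPK ρ hρ) hPd (sUnion_subset fun ρ hρ => ?_) (fun ρ => x (r ρ))
    (fun ρ => y (r ρ)) (fun ρ hρ => hx _ (hr ρ hρ).1) fun ρ hρ => hy _ (hr ρ hρ).1
  rw [← (hr ρ hρ).2]
  exact hκγ _ (hr ρ hρ).1

end

variable [IsUniformAddMonoid X] [IsUniformAddMonoid Z] [T2Space Z]

/-- Regularity with respect to `ν` in terms of the variation of `ℓ`. -/
theorem mem_regularSets_nu_iff (hℓ : R.IsRieszIntegral ℓ) {α : Set S} :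
    α ∈ regularSets R.K R.G R.B (R.nu ℓ) ↔
      ∀ d : Z → Z → ℝ, IsContractivePseudometric d → ∀ A ∈ R.B, ∀ ε > 0,
        ∃ κ ∈ R.K, ∃ γ ∈ R.G, κ ⊆ α ∧ α ⊆ γ ∧ R.VariationLE ℓ d A ε (γ \ κ) := by
  constructor
  · intro h d hd A hA ε hε
    obtain ⟨κ, hκ, γ, hγ, h1, h2, h3⟩ := h A hA {p | d p.1 p.2 ≤ ε}
      (mem_of_superset (hd.mem_uniformity ε hε) fun p (hp : d p.1 p.2 < ε) => hp.le)
    exact ⟨κ, hκ, γ, hγ, h1, h2, variationLE_of_isSmall_nu hℓ hd hA h3⟩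
  · intro h A hA V hV
    obtain ⟨d, hd, hdV⟩ := exists_isContractivePseudometric hV
    obtain ⟨κ, hκ, γ, hγ, h1, h2, h3⟩ := h d hd A hA (1 / 2) (by norm_num)
    exact ⟨κ, hκ, γ, hγ, h1, h2, isSmall_nu_of_variationLE hℓ hd hA (R.G_diff _ hκ _ hγ) h3
      fun a b hab => hdV a b (hab.trans_lt (by norm_num))⟩

theorem G_subset_regularSets_nu (hℓ : R.IsRieszIntegral ℓ) :
    R.G ⊆ regularSets R.K R.G R.B (R.nu ℓ) := by
  refine fun γ hγ => (mem_regularSets_nu_iff hℓ).2 fun d hd A hA ε hε => ?_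
  obtain ⟨κ, hκ, hκγ, h⟩ := exists_K_variationLE hℓ hd hγ hA hε
  exact ⟨κ, hκ, γ, hγ, hκγ, Subset.rfl, h⟩

theorem isSetAlgebra_regularSets_nu (hℓ : R.IsRieszIntegral ℓ) :
    MeasureTheory.IsSetAlgebra (regularSets R.K R.G R.B (R.nu ℓ)) := by
  refine ⟨G_subset_regularSets_nu hℓ R.G_empty, fun α hα => ?_, fun α β hα hβ => ?_⟩
  · rw [mem_regularSets_nu_iff hℓ] at hα ⊢
    intro d hd A hA ε hε
    obtain ⟨C, hAC⟩ := R.exists_dominates hA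
    obtain ⟨κ, hκ, γ, hγ, h1, h2, h3⟩ := hα d hd C hAC.mem (ε / 2) (by positivity)
    -- The whole set need not belong to `K`, so that the complement of `γ` has to be truncated.
    obtain ⟨κ', hκ', -, h4⟩ := exists_K_variationLE hℓ hd R.univ_mem_G hAC.mem (half_pos hε)
    refine ⟨κ' \ γ, R.K_diff _ hκ' _ hγ, univ \ κ, R.G_diff _ hκ _ R.univ_mem_G,
      fun t ht hα => ht.2 (h2 hα), fun t ht => ⟨mem_univ t, fun h => ht (h1 h)⟩, ?_⟩
    refine (variationLE_union hℓ hd hA hAC (R.G_diff _ hκ _ hγ) (R.G_diff _ hκ' _ R.univ_mem_G)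
      h3 h4).mono Subset.rfl (add_halves ε).le fun t ht => ?_
    by_cases htγ : t ∈ γ
    · exact Or.inl ⟨htγ, ht.1.2⟩
    · exact Or.inr ⟨mem_univ t, fun h => ht.2 ⟨h, htγ⟩⟩
  · rw [mem_regularSets_nu_iff hℓ] at hα hβ ⊢
    intro d hd A hA ε hε
    obtain ⟨C, hAC⟩ := R.exists_dominates hA
    obtain ⟨κ, hκ, γ, hγ, h1, h2, h3⟩ := hα d hd C hAC.mem (ε / 2) (by positivity)
    obtain ⟨κ', hκ', γ', hγ', h1', h2', h3'⟩ := hβ d hd C hAC.mem (ε / 2) (by positivity)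
    refine ⟨κ ∪ κ', R.K_union _ hκ _ hκ', γ ∪ γ', R.G_union _ hγ _ hγ', union_subset_union h1 h1',
      union_subset_union h2 h2', ?_⟩
    refine (variationLE_union hℓ hd hA hAC (R.G_diff _ hκ _ hγ) (R.G_diff _ hκ' _ hγ')
      h3 h3').mono Subset.rfl (add_halves ε).le ?_
    rintro t ⟨ht | ht, hκκ'⟩
    · exact Or.inl ⟨ht, fun h => hκκ' (Or.inl h)⟩
    · exact Or.inr ⟨ht, fun h => hκκ' (Or.inr h)⟩

end RieszSystem

/-! ### The Riesz measure of a Riesz integral -/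

namespace RieszSystem

variable {S X Z : Type*} [AddCommMonoid X] [UniformSpace X] {R : RieszSystem S X}
  [AddCommMonoid Z] [UniformSpace Z] {ℓ : R.F → Z} [IsUniformAddMonoid Z] [T2Space Z]

theorem tau_union (hℓ : R.IsRieszIntegral ℓ) {κ₁ κ₂ : Set S} (hκ₁ : κ₁ ∈ R.K) (hκ₂ : κ₂ ∈ R.K)
    (hdisj : Disjoint κ₁ κ₂) : R.tau ℓ (κ₁ ∪ κ₂) = R.tau ℓ κ₁ + R.tau ℓ κ₂ := by
  ext x
  refine eq_of_forall_pseudometric fun d hd ε hε => ?_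
  have hA := R.hull_mem x
  have hx := R.mem_hull x
  have hκ := R.K_union _ hκ₁ _ hκ₂
  have hε' : 0 < ε / 3 := by positivity
  obtain ⟨γ₁, hγ₁, hκγ₁, h₁⟩ := exists_nhd_dist_tau_le hℓ hd hκ₁ hA hx hε'
  obtain ⟨γ₂, hγ₂, hκγ₂, h₂⟩ := exists_nhd_dist_tau_le hℓ hd hκ₂ hA hx hε'
  obtain ⟨γ, hγ, hκγ, h⟩ := exists_nhd_dist_tau_le hℓ hd hκ hA hx hε'
  have hi : ∀ b : Bool, b ∈ Finset.univ := Finset.mem_univ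
  let κ : Bool → Set S := fun b => cond b κ₁ κ₂
  obtain ⟨β, hβ, hκβ, hβγ, hβd⟩ := R.exists_disjoint_nhds (Finset.univ : Finset Bool)
    (κ := κ) (γ := fun b => cond b γ₁ γ₂ ∩ γ)
    (by rintro (_ | _) -; exacts [hκ₂, hκ₁])
    (by rintro (_ | _) -; exacts [R.G_inter _ hγ₂ _ hγ, R.G_inter _ hγ₁ _ hγ])
    (by
      rintro (_ | _) -
      exacts [subset_inter hκγ₂ (subset_union_right.trans hκγ),
        subset_inter hκγ₁ (subset_union_left.trans hκγ)])
    (by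
      rintro (_ | _) - (_ | _) - hne
      exacts [absurd rfl hne, hdisj.symm, hdisj, absurd rfl hne])
  obtain ⟨f, hf⟩ := exists_bumps_family (s := Finset.univ) (κ := κ) hA
    (by rintro (_ | _) -; exacts [hκ₂, hκ₁]) hβ hκβ (x := fun _ => x) fun _ _ => hx
  have hfβ : ∀ b ∈ Finset.univ, SupportedBy R.K (f b : S → X) (β b) := fun b hb => (hf b hb).2.2
  have hsum : ∑ b, f b ∈ R.bumps x (κ₁ ∪ κ₂) γ (hull R.B x) := by
    refine ⟨(sum_mem_FS hβd hfβ hA fun b hb => (hf b hb).1).1, ?_,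
      supportedBy_sum _ fun b hb => (hfβ b hb).mono ((hβγ b hb).trans inter_subset_right)⟩
    have hω := fun b => (hf b (hi b)).2.1
    choose ω hω hκω hfω using hω
    refine ⟨(ω true ∩ β true) ∪ (ω false ∩ β false), R.G_union _ (R.G_inter _ (hω _) _ (hβ _ (hi _)))
      _ (R.G_inter _ (hω _) _ (hβ _ (hi _))), union_subset_union
        (subset_inter (hκω true) (hκβ true (hi _))) (subset_inter (hκω false) (hκβ false (hi _))), ?_⟩
    rintro t (ht | ht)
    · rw [sum_apply_of_mem hβd hfβ (hi true) ht.2]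
      exact hfω _ _ ht.1
    · rw [sum_apply_of_mem hβd hfβ (hi false) ht.2]
      exact hfω _ _ ht.1
  have e := h _ hsum
  rw [hℓ.map_sum hβd hfβ hβ, Fintype.sum_bool] at e
  have e₁ := h₁ _ (bumps_mono Subset.rfl ((hβγ true (hi _)).trans inter_subset_left) (hf true (hi _)))
  have e₂ := h₂ _ (bumps_mono Subset.rfl ((hβγ false (hi _)).trans inter_subset_left)
    (hf false (hi _)))
  have t₁ := hd.add_add (ℓ (f true)) (R.tau ℓ κ₁ x) (ℓ (f false)) (R.tau ℓ κ₂ x)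
  have t₂ := hd.triangle (R.tau ℓ (κ₁ ∪ κ₂) x) (ℓ (f true) + ℓ (f false))
    (R.tau ℓ κ₁ x + R.tau ℓ κ₂ x)
  rw [hd.symm] at e
  simp only [Pi.add_apply]
  linarith

variable [IsUniformAddMonoid X]

theorem nu_union_of_disjoint (hℓ : R.IsRieszIntegral ℓ) {α β : Set S}
    (hα : α ∈ regularSets R.K R.G R.B (R.nu ℓ)) (hβ : β ∈ regularSets R.K R.G R.B (R.nu ℓ))
    (hdisj : Disjoint α β) : R.nu ℓ (α ∪ β) = R.nu ℓ α + R.nu ℓ β := by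
  rw [mem_regularSets_nu_iff hℓ] at hα hβ
  ext x
  refine eq_of_forall_pseudometric fun d hd ε hε => ?_
  have hA := R.hull_mem x
  have hx := R.mem_hull x
  obtain ⟨C, hC⟩ := R.exists_dominates hA
  obtain ⟨D, hD⟩ := R.exists_dominates hC.mem
  obtain ⟨κ, hκ, γ, hγ, h1, h2, h3⟩ := hα d hd D hD.mem (ε / 16) (by positivity)
  obtain ⟨κ', hκ', γ', hγ', h1', h2', h3'⟩ := hβ d hd D hD.mem (ε / 16) (by positivity)
  have h4 : R.VariationLE ℓ d C (ε / 16 + ε / 16) ((γ ∪ γ') \ (κ ∪ κ')) := by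
    refine (variationLE_union hℓ hd hC.mem hD (R.G_diff _ hκ _ hγ) (R.G_diff _ hκ' _ hγ')
      h3 h3').mono Subset.rfl le_rfl ?_
    rintro t ⟨ht | ht, hκκ'⟩
    · exact Or.inl ⟨ht, fun h => hκκ' (Or.inl h)⟩
    · exact Or.inr ⟨ht, fun h => hκκ' (Or.inr h)⟩
  have e := dist_tau_nu_le hℓ hd hA hC hx hκ hγ (h1.trans h2)
    (h3.mono hD.subset le_rfl Subset.rfl) h1 h2
  have e' := dist_tau_nu_le hℓ hd hA hC hx hκ' hγ' (h1'.trans h2')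
    (h3'.mono hD.subset le_rfl Subset.rfl) h1' h2'
  have e'' := dist_tau_nu_le hℓ hd hA hC hx (R.K_union _ hκ _ hκ') (R.G_union _ hγ _ hγ')
    (union_subset_union (h1.trans h2) (h1'.trans h2')) h4 (union_subset_union h1 h1')
    (union_subset_union h2 h2')
  rw [tau_union hℓ hκ hκ' (hdisj.mono h1 h1'), hd.symm] at e''
  have t₁ := hd.add_add (R.tau ℓ κ x) (R.nu ℓ α x) (R.tau ℓ κ' x) (R.nu ℓ β x)
  have t₂ := hd.triangle (R.nu ℓ (α ∪ β) x) (R.tau ℓ κ x + R.tau ℓ κ' x)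
    (R.nu ℓ α x + R.nu ℓ β x)
  simp only [Pi.add_apply] at e'' ⊢
  linarith

theorem nu_union_add_inter (hℓ : R.IsRieszIntegral ℓ) {α β : Set S}
    (hα : α ∈ regularSets R.K R.G R.B (R.nu ℓ)) (hβ : β ∈ regularSets R.K R.G R.B (R.nu ℓ)) :
    R.nu ℓ (α ∪ β) + R.nu ℓ (α ∩ β) = R.nu ℓ α + R.nu ℓ β := by
  have hR := isSetAlgebra_regularSets_nu hℓ
  have h1 := nu_union_of_disjoint hℓ (hR.sdiff_mem hα hβ) hβ disjoint_sdiff_left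
  have h2 := nu_union_of_disjoint hℓ (hR.sdiff_mem hα hβ) (hR.inter_mem hα hβ)
    (disjoint_sdiff_left.mono_right inter_subset_right)
  rw [sdiff_union_self] at h1
  rw [sdiff_union_inter] at h2
  rw [h1, h2]
  abel

section

variable (hℓ : R.IsRieszIntegral ℓ) {d : Z → Z → ℝ} (hd : IsContractivePseudometric d)
include hℓ hd

/-- Disjoint regular sets `ρ` contain members `κ ρ` of `K` that have small neighbourhoods `γ ρ`,
such that every sum `∑ ν ρ (x ρ)` is close to the integral of a sum of functions that equal
`x ρ` over `κ ρ` and are supported by small disjoint neighbourhoods of `κ ρ`. -/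
theorem exists_dist_sum_nu_le {A C : Set X} (hA : A ∈ R.B) (hAC : R.Dominates A C)
    {P : Finset (Set S)} (hP : (P : Set (Set S)) ⊆ regularSets R.K R.G R.B (R.nu ℓ)) {ε : ℝ}
    (hε : 0 < ε) :
    ∃ κ γ : Set S → Set S, (∀ ρ ∈ P, κ ρ ∈ R.K) ∧ (∀ ρ ∈ P, γ ρ ∈ R.G) ∧ (∀ ρ ∈ P, κ ρ ⊆ ρ) ∧
      (∀ ρ ∈ P, κ ρ ⊆ γ ρ) ∧
      R.VariationLE ℓ d C ε ((⋃ ρ ∈ P, γ ρ) \ ⋃ ρ ∈ P, κ ρ) ∧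
      ∀ x : Set S → X, (∀ ρ ∈ P, x ρ ∈ A) → ∃ β : Set S → Set S, (∀ ρ ∈ P, β ρ ∈ R.G) ∧
        (∀ ρ ∈ P, κ ρ ⊆ β ρ) ∧ ∀ (β' : Set S → Set S) (f : Set S → R.F),
          (∀ ρ ∈ P, β' ρ ∈ R.G) → (∀ ρ ∈ P, β' ρ ⊆ β ρ) →
          (∀ ρ ∈ P, ∀ ρ' ∈ P, ρ ≠ ρ' → Disjoint (β' ρ) (β' ρ')) →
          (∀ ρ ∈ P, f ρ ∈ R.bumps (x ρ) (κ ρ) (β' ρ) A) →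
          d (ℓ (∑ ρ ∈ P, f ρ)) (∑ ρ ∈ P, R.nu ℓ ρ (x ρ)) ≤ 5 * ε := by
  obtain ⟨D, hD⟩ := R.exists_dominates hAC.mem
  have key : ∀ ρ, ∃ κ γ, ρ ∈ P → κ ∈ R.K ∧ γ ∈ R.G ∧ κ ⊆ ρ ∧ ρ ⊆ γ ∧
      R.VariationLE ℓ d D (ε / (P.card + 1)) (γ \ κ) := by
    intro ρ
    by_cases hρ : ρ ∈ P
    · obtain ⟨κ, hκ, γ, hγ, h⟩ := (mem_regularSets_nu_iff hℓ).1 (hP hρ) d hd D hD.mem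
        (ε / (P.card + 1)) (by positivity)
      exact ⟨κ, γ, fun _ => ⟨hκ, hγ, h⟩⟩
    · exact ⟨∅, ∅, fun h => absurd h hρ⟩
  choose κ γ h using key
  have hκ : ∀ ρ ∈ P, κ ρ ∈ R.K := fun ρ hρ => (h ρ hρ).1
  have hκγ : ∀ ρ ∈ P, κ ρ ⊆ γ ρ := fun ρ hρ => (h ρ hρ).2.2.1.trans (h ρ hρ).2.2.2.1
  refine ⟨κ, γ, hκ, fun ρ hρ => (h ρ hρ).2.1, fun ρ hρ => (h ρ hρ).2.2.1, hκγ, ?_,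
    fun x hx => ?_⟩
  · refine (variationLE_biUnion hℓ hd hAC.mem hD
      (fun ρ hρ => R.G_diff _ (hκ ρ hρ) _ (h ρ hρ).2.1) fun ρ hρ => (h ρ hρ).2.2.2.2).mono Subset.rfl
      (sum_div_card_succ_le P hε.le) fun t ht => ?_
    obtain ⟨ρ, hρ, htρ⟩ := mem_iUnion₂.1 ht.1
    exact mem_iUnion₂.2 ⟨ρ, hρ, htρ, fun hκ => ht.2 (mem_iUnion₂.2 ⟨ρ, hρ, hκ⟩)⟩
  · obtain ⟨β, hβ, hκβ, hf⟩ := exists_nhds_dist_sum_tau_le hℓ hd hA P hκ hx hε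
    refine ⟨β, hβ, hκβ, fun β' f hβ' hβ'β hdisj hfβ' => ?_⟩
    have e₁ := hf β' f hβ' hβ'β hdisj hfβ'
    have e₂ : d (∑ ρ ∈ P, R.tau ℓ (κ ρ) (x ρ)) (∑ ρ ∈ P, R.nu ℓ ρ (x ρ)) ≤ 4 * ε := by
      refine (hd.sum_sum P _ _).trans (((Finset.sum_le_sum fun ρ hρ => ?_).trans_eq
        (Finset.mul_sum _ _ _).symm).trans
        (mul_le_mul_of_nonneg_left (sum_div_card_succ_le P hε.le) (by norm_num)))
      exact dist_tau_nu_le hℓ hd hA hAC (hx ρ hρ) (hκ ρ hρ) (h ρ hρ).2.1 (hκγ ρ hρ)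
        ((h ρ hρ).2.2.2.2.mono hD.subset le_rfl Subset.rfl) (h ρ hρ).2.2.1 (h ρ hρ).2.2.2.1
    have := hd.triangle (ℓ (∑ ρ ∈ P, f ρ)) (∑ ρ ∈ P, R.tau ℓ (κ ρ) (x ρ))
      (∑ ρ ∈ P, R.nu ℓ ρ (x ρ))
    linarith

end

theorem uniformlyPartitionContinuous_nu (hℓ : R.IsRieszIntegral ℓ) :
    UniformlyPartitionContinuous R.K R.G R.B (R.nu ℓ) := by
  intro W hW A hA
  obtain ⟨d, hd, hdW⟩ := exists_isContractivePseudometric hW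
  obtain ⟨C, hAC⟩ := R.exists_dominates hA
  obtain ⟨U, hU, hcomp⟩ := exists_comparison hℓ hd hA hAC (ε := 1 / 16) (by norm_num)
  refine ⟨U, hU, fun P hP hPd x y hx hy hxy => hdW _ _ ?_⟩
  obtain ⟨κ, γ, hκ, hγ, hκρ, hκγ, hvar, hsum⟩ :=
    exists_dist_sum_nu_le hℓ hd hA hAC hP (ε := 1 / 16) (by norm_num)
  obtain ⟨β₁, hβ₁, hκβ₁, h₁⟩ := hsum x hx
  obtain ⟨β₂, hβ₂, hκβ₂, h₂⟩ := hsum y hy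
  obtain ⟨β, hβ, hκβ, hβγ, hβd⟩ := R.exists_disjoint_nhds P hκ
    (γ := fun ρ => β₁ ρ ∩ β₂ ρ ∩ γ ρ)
    (fun ρ hρ => R.G_inter _ (R.G_inter _ (hβ₁ ρ hρ) _ (hβ₂ ρ hρ)) _ (hγ ρ hρ))
    (fun ρ hρ => subset_inter (subset_inter (hκβ₁ ρ hρ) (hκβ₂ ρ hρ)) (hκγ ρ hρ))
    fun ρ hρ ρ' hρ' hne => (hPd hρ hρ' hne).mono (hκρ ρ hρ) (hκρ ρ' hρ')
  obtain ⟨f, hf⟩ := exists_bumps_family hA hκ hβ hκβ hx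
  obtain ⟨g, hg⟩ := exists_bumps_family hA hκ hβ hκβ hy
  have e₁ := h₁ β f hβ (fun ρ hρ => (hβγ ρ hρ).trans (inter_subset_left.trans inter_subset_left))
    hβd hf
  have e₂ := h₂ β g hβ (fun ρ hρ => (hβγ ρ hρ).trans (inter_subset_left.trans inter_subset_right))
    hβd hg
  have key : ∀ ρ, ∃ ω, ρ ∈ P → ω ∈ R.G ∧ κ ρ ⊆ ω ∧ ω ⊆ β ρ ∧
      ∀ t ∈ ω, (f ρ : S → X) t = x ρ ∧ (g ρ : S → X) t = y ρ := by
    intro ρ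
    by_cases hρ : ρ ∈ P
    · obtain ⟨ω, hω, h1, h2⟩ := (hf ρ hρ).2.1
      obtain ⟨ω', hω', h1', h2'⟩ := (hg ρ hρ).2.1
      exact ⟨ω ∩ ω' ∩ β ρ, fun _ => ⟨R.G_inter _ (R.G_inter _ hω _ hω') _ (hβ ρ hρ),
        subset_inter (subset_inter h1 h1') (hκβ ρ hρ), inter_subset_right,
        fun t ht => ⟨h2 t ht.1.1, h2' t ht.1.2⟩⟩⟩
    · exact ⟨∅, fun h => absurd h hρ⟩
  choose ω hω using key
  have hfβ : ∀ ρ ∈ P, SupportedBy R.K (f ρ : S → X) (β ρ) := fun ρ hρ => (hf ρ hρ).2.2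
  have hgβ : ∀ ρ ∈ P, SupportedBy R.K (g ρ : S → X) (β ρ) := fun ρ hρ => (hg ρ hρ).2.2
  have hβγ' : ⋃ ρ ∈ P, β ρ ⊆ ⋃ ρ ∈ P, γ ρ :=
    iUnion₂_mono fun ρ hρ => (hβγ ρ hρ).trans inter_subset_right
  have e₃ := hcomp (1 / 16) _ (R.biUnion_mem_K P hκ) _ (R.biUnion_mem_G P hβ)
    (iUnion₂_mono hκβ) (hvar.mono Subset.rfl le_rfl (sdiff_subset_sdiff_left hβγ')) 0
    (zero_mem_FS hA) _ (sum_mem_FS hβd hfβ hA fun ρ hρ => (hf ρ hρ).1) _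
    (sum_mem_FS hβd hgβ hA fun ρ hρ => (hg ρ hρ).1)
    (supportedBy_sum P fun ρ hρ => (hfβ ρ hρ).mono (subset_iUnion₂_of_subset ρ hρ Subset.rfl))
    (supportedBy_sum P fun ρ hρ => (hgβ ρ hρ).mono (subset_iUnion₂_of_subset ρ hρ Subset.rfl))
    ⟨⋃ ρ ∈ P, ω ρ, R.biUnion_mem_G P fun ρ hρ => (hω ρ hρ).1,
      iUnion₂_mono fun ρ hρ => (hω ρ hρ).2.1, iUnion₂_mono fun ρ hρ => (hω ρ hρ).2.2.1,
      fun t ht => by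
        obtain ⟨ρ, hρ, ht⟩ := mem_iUnion₂.1 ht
        obtain ⟨h1, h2⟩ := (hω ρ hρ).2.2.2 t ht
        have htβ := (hω ρ hρ).2.2.1 ht
        rw [sum_apply_of_mem hβd hfβ hρ htβ, sum_apply_of_mem hβd hgβ hρ htβ, h1, h2]
        exact hxy ρ hρ⟩
  rw [zero_add, zero_add] at e₃
  have t₁ := hd.triangle (∑ ρ ∈ P, R.nu ℓ ρ (x ρ)) (ℓ (∑ ρ ∈ P, f ρ)) (∑ ρ ∈ P, R.nu ℓ ρ (y ρ))
  have t₂ := hd.triangle (ℓ (∑ ρ ∈ P, f ρ)) (ℓ (∑ ρ ∈ P, g ρ)) (∑ ρ ∈ P, R.nu ℓ ρ (y ρ))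
  rw [hd.symm] at e₁
  linarith

theorem isRelativelyComplete_partialSums_nu (hℓ : R.IsRieszIntegral ℓ) {A : Set X}
    (hA : A ∈ R.B) : IsRelativelyComplete (partialSums R.K R.G R.B (R.nu ℓ) A) := by
  have hsub : partialSums R.K R.G R.B (R.nu ℓ) A ⊆ closure (ℓ '' R.FB A) := by
    rintro _ ⟨P, hP, hPd, x, hx, rfl⟩
    refine mem_closure_of_forall_pseudometric fun d hd ε hε => ?_
    obtain ⟨C, hAC⟩ := R.exists_dominates hA
    obtain ⟨κ, γ, hκ, -, hκρ, -, -, hsum⟩ :=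
      exists_dist_sum_nu_le hℓ hd hA hAC hP (ε := ε / 5) (by positivity)
    obtain ⟨β₁, hβ₁, hκβ₁, h⟩ := hsum x hx
    obtain ⟨β, hβ, hκβ, hββ₁, hβd⟩ := R.exists_disjoint_nhds P hκ hβ₁ hκβ₁
      fun ρ hρ ρ' hρ' hne => (hPd hρ hρ' hne).mono (hκρ ρ hρ) (hκρ ρ' hρ')
    obtain ⟨f, hf⟩ := exists_bumps_family hA hκ hβ hκβ hx
    refine ⟨_, mem_image_of_mem ℓ (sum_mem_FS hβd (fun ρ hρ => (hf ρ hρ).2.2) hA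
      fun ρ hρ => (hf ρ hρ).1).1, ?_⟩
    rw [hd.symm]
    have := h β f hβ hββ₁ hβd hf
    linarith
  intro l hl hle
  have hcl := closure_minimal hsub isClosed_closure
  obtain ⟨z, -, hz⟩ := hℓ.relativelyComplete A hA l hl (hle.trans (principal_mono.2 hcl))
  have := hl.1
  exact ⟨z, isClosed_closure.mem_of_tendsto (f := id) (tendsto_id'.2 hz) (le_principal_iff.1 hle),
    hz⟩

theorem sBounded_nu (hℓ : R.IsRieszIntegral ℓ) : SBounded R.K R.G R.B (R.nu ℓ) := by
  intro A hA α hα hdisj V hV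
  obtain ⟨d, hd, hdV⟩ := exists_isContractivePseudometric hV
  obtain ⟨C, hAC⟩ := R.exists_dominates hA
  have key := fun n => (mem_regularSets_nu_iff hℓ).1 (hα n) d hd C hAC.mem (1 / 6 / 2 / 2 ^ n)
    (by positivity)
  choose κ hκ γ hγ hκα hαγ hvar using key
  -- A common point of `γ i` and `γ n` cannot belong to both `κ i` and `κ n`, as these are disjoint.
  obtain ⟨m, hm⟩ := exists_variationLE_of_almost_disjoint hℓ hd hA hAC (ε := 1 / 6) (by norm_num)
    hγ (fun n => R.G_diff _ (hκ n) _ (hγ n)) hvar (sum_geometric_le (by norm_num)) (by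
      rintro i n hin t ⟨hti, htn⟩
      by_cases ht : t ∈ κ i
      · refine mem_iUnion₂.2 ⟨n, by simp, htn, fun h => ?_⟩
        exact disjoint_left.1 (hdisj hin.ne) (hκα i ht) (hκα n h)
      · exact mem_iUnion₂.2 ⟨i, by simpa using hin.le.trans_lt (Nat.lt_succ_self n), hti, ht⟩)
  refine ⟨m, fun n hn => ?_⟩
  obtain ⟨ω, hω, hγω, h⟩ := isSmall_nu_of_variationLE hℓ hd hA (hγ n) (hm n hn) (W := V)
    fun a b hab => hdV a b (hab.trans_lt (by norm_num))
  exact ⟨ω, hω, (hαγ n).trans hγω, h⟩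

end RieszSystem

theorem theorem4p12 {S X Z : Type*}
    [AddCommMonoid X] [UniformSpace X] [IsUniformAddMonoid X]
    [AddCommMonoid Z] [UniformSpace Z] [IsUniformAddMonoid Z] [T2Space Z]
    (R : RieszSystem S X) (ℓ : R.F → Z) (hℓ : R.IsRieszIntegral ℓ) :
    (∀ κ ∈ R.K, ∀ A ∈ R.B, ∀ x ∈ A,
      (R.tauFilter ℓ κ x A).NeBot ∧ R.tauFilter ℓ κ x A ≤ 𝓝 (R.tau ℓ κ x)) ∧
    (∀ γ ∈ R.G, Tendsto (fun κ : RieszSystem.KBelow R.K γ => R.tau ℓ κ.1) atTop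
      (𝓝 (R.xi ℓ γ))) ∧
    (∀ α : Set S, Tendsto (fun γ : RieszSystem.GAbove R.G α => R.xi ℓ γ.1) atBot
      (𝓝 (R.nu ℓ α))) ∧
    Riesz.IsRieszMeasure R.K R.G R.B (R.nu ℓ) := by
  refine ⟨fun κ hκ A hA x hx => ⟨RieszSystem.tauFilter_neBot ℓ hκ hA hx,
      RieszSystem.tauFilter_le_nhds_tau hℓ hκ hA hx⟩,
    fun γ hγ => RieszSystem.tendsto_tau hℓ hγ, RieszSystem.tendsto_xi hℓ, ?_⟩
  refine ⟨RieszSystem.G_subset_regularSets_nu hℓ, RieszSystem.isSetAlgebra_regularSets_nu hℓ,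
    RieszSystem.nu_empty hℓ, fun α hα β hβ => RieszSystem.nu_union_add_inter hℓ hα hβ,
    fun γ hγ => ?_, fun α => ?_, RieszSystem.uniformlyPartitionContinuous_nu hℓ,
    RieszSystem.sBounded_nu hℓ, fun A hA => RieszSystem.isRelativelyComplete_partialSums_nu hℓ hA⟩
  · rw [RieszSystem.nu_eq_xi hℓ hγ]
    exact (RieszSystem.tendsto_tau hℓ hγ).congr fun κ => (RieszSystem.nu_eq_tau hℓ κ.2.1).symm
  · exact (RieszSystem.tendsto_xi hℓ α).congr fun γ => (RieszSystem.nu_eq_xi hℓ γ.2.1).symm
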